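/- Let $K$ be a finite abstract simplicial complex with vertex set $S$ (the empty set is a simplex of $K$, and $\dim\sigma=|\sigma|-1$). Let $(C_*(K),d)$ and $(C^*(K),\delta)$ denote its simplicial chain and cochain complexes, where both chain groups are the free abelian group on the (oriented) nonempty simplices, $d(v_0,\dots,v_k)=\sum_{i}(-1)^i(v_0,\dots,\hat v_i,\dots,v_k)$ (with $d(v)=0$) and $\delta(v_0,\dots,v_k)=\sum_{v\in S}(v,v_0,\dots,v_k)$, a sequence being $0$ if it has a repeated entry or does not span a simplex of $K$. The reduced versions $\widetilde C_*(K)$, $\widetilde C^*(K)$ include the empty simplex, in dimension $-1$. Let $N^{*,*}(K)$ be the subcomplex of the bicomplex $C_*(K)\otimes C^*(K)$, with differential $\Delta(\sigma\otimes\tau)=d\sigma\otimes\tau+(-1)^{|\sigma|}\sigma\otimes\delta\tau$, that is generated by all $\sigma\otimes\tau$ with $\sigma\subseteq\tau$; here $\sigma\otimes\tau$ has bidegree $(p,q)=(\dim\sigma,\dim\tau)$. Let $(N_{*,*}(K),D)=(\operatorname{Hom}_{\mathbb Z}(N^{*,*}(K),\mathbb Z),\Delta^*)$ be its dual, and define $\widetilde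 N^{*,*}(K)$ and $\widetilde N_{*,*}(K)$ in the same way from the reduced complexes. For an abelian group $G$ let $\mathcal H^{p,q}(K;G)$ be the term $E_2^{p,q}$ of the spectral sequence of the total complex of $N^{*,*}(K)\otimes G$ (total degree $q-p$) with the filtration $F^p=\bigoplus_{i\le p}N^{i,*}(K)\otimes G$, so that $E_1^{p,q}=H^{q-p}(F^p/F^{p-1})$, and let $\mathcal H_{p,q}(K;G)$ be the term $E^2_{p,q}$ of the spectral sequence of the total complex of $N_{*,*}(K)\otimes G$ with the filtration $F_p=\bigoplus_{i\ge p}N_{i,*}(K)\otimes G$, so that $E^1_{p,q}=H_{q-p}(F_p/F_{p+1})$. Define $\widetilde{\mathcal H}^{p,q}(K;G)$ and $\widetilde{\mathcal H}_{p,q}(K;G)$ in the same way from $\widetilde N^{*,*}(K)$ and $\widetilde N_{*,*}(K)$. Let $\sigma\in K$ be a simplex with $\dim\sigma>0$, and let $K'$ be the stellar subdivision of $K$ at $\sigma$, $$K'=(K\setminus\operatorname{star}_K\sigma)\cup\operatorname{cone}(\partial\sigma*\operatorname{link}_K\sigma),$$ where $\operatorname{star}_K\sigma=\{\tau\in K:\sigma\cup\tau\in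 K\}$, $\operatorname{link}_K\sigma=\{\tau\in K:\sigma\cup\tau\in K,\ \sigma\cap\tau=\varnothing\}$, $\partial\sigma$ is the complex of all proper faces of $\sigma$, $*$ is the join, and the apex of the cone is a new vertex. Then for every abelian group $G$ and all $p,q\in\mathbb Z$, $$\mathcal H^{p,q}(K';G)\cong\mathcal H^{p,q}(K;G),\qquad \widetilde{\mathcal H}^{p,q}(K';G)\cong\widetilde{\mathcal H}^{p,q}(K;G),$$ $$\mathcal H_{p,q}(K';G)\cong\mathcal H_{p,q}(K;G),\qquad \widetilde{\mathcal H}_{p,q}(K';G)\cong\widetilde{\mathcal H}_{p,q}(K;G).$$ -/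

import Mathlib

open scoped TensorProduct

/-- A finite abstract simplicial complex whose vertices are taken from `α`: a finite family of
finite subsets of `α` that contains the empty set and is closed under passing to subsets.
Its vertex set is `{v | {v} ∈ faces}`, which need not be all of `α`. -/
structure FinComplex (α : Type*) where
  faces : Finset (Finset α)
  empty_mem : ∅ ∈ faces
  down_closed : ∀ ⦃σ τ : Finset α⦄, σ ∈ faces → τ ⊆ σ → τ ∈ faces

namespace FinComplex

section Subdivision

variable {α : Type*} [DecidableEq α]

/-- The (closed) star `{τ ∈ K | σ ∪ τ ∈ K}`. -/
def star (K : FinComplex α) (σ : Finset α) : Finset (Finset α) :=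
  K.faces.filter fun τ => σ ∪ τ ∈ K.faces

/-- The link `{τ ∈ K | σ ∪ τ ∈ K, σ ∩ τ = ∅}`. -/
def link (K : FinComplex α) (σ : Finset α) : Finset (Finset α) :=
  K.faces.filter fun τ => σ ∪ τ ∈ K.faces ∧ σ ∩ τ = ∅

/-- The boundary `∂σ` of a simplex: all its proper faces (the empty one included). -/
def boundary (σ : Finset α) : Finset (Finset α) := σ.ssubsets

/-- The join `A * B = {s ∪ t | s ∈ A, t ∈ B}` of two complexes with disjoint vertex sets. -/
def join (A B : Finset (Finset α)) : Finset (Finset α) := Finset.image₂ (· ∪ ·) A B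

/-- The cone over `A` with apex `a`: the join of `A` with the one-point complex `{∅, {a}}`. -/
def cone (a : α) (A : Finset (Finset α)) : Finset (Finset α) := join {∅, {a}} A

theorem mem_cone_boundary_link (K : FinComplex α) (σ : Finset α) (a : α) (ρ : Finset α) :
    ρ ∈ cone a (join (boundary σ) (K.link σ)) ↔
      ∃ u ⊆ ({a} : Finset α), ∃ s, s ⊂ σ ∧ ∃ t ∈ K.link σ, ρ = u ∪ (s ∪ t) := by
  simp only [cone, join, boundary, Finset.mem_image₂, Finset.mem_ssubsets,
    Finset.subset_singleton_iff, Finset.mem_insert, Finset.mem_singleton]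
  constructor
  · rintro ⟨u, hu, _, ⟨s, hs, t, ht, rfl⟩, rfl⟩
    exact ⟨u, hu, s, hs, t, ht, rfl⟩
  · rintro ⟨u, hu, s, hs, t, ht, rfl⟩
    exact ⟨u, hu, _, ⟨s, hs, t, ht, rfl⟩, rfl⟩

/-- The stellar subdivision of `K` at a nonempty simplex `σ`,
`(K ∖ star σ) ∪ cone (∂σ * link σ)`, where `a` is the apex of the cone. It is meant for an `a`
that is not a vertex of `K`. -/
def stellarSubdivision (K : FinComplex α) (σ : Finset α) (hσ : σ ∈ K.faces)
    (hne : σ.Nonempty) (a : α) : FinComplex α where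
  faces := (K.faces \ K.star σ) ∪ cone a (join (boundary σ) (K.link σ))
  empty_mem := by
    refine Finset.mem_union_right _ ((mem_cone_boundary_link K σ a _).2 ?_)
    refine ⟨∅, Finset.empty_subset _, ∅, ?_, ∅, ?_, by simp⟩
    · exact Finset.empty_ssubset.2 hne
    · simp [link, K.empty_mem, hσ]
  down_closed := by
    intro τ ρ hτ hρ
    rcases Finset.mem_union.1 hτ with h | h
    · obtain ⟨hτK, hτs⟩ := Finset.mem_sdiff.1 h
      have hρK := K.down_closed hτK hρ
      by_cases hs : ρ ∈ K.star σ
      · refine Finset.mem_union_right _ ((mem_cone_boundary_link K σ a _).2 ?_)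
        have hu : σ ∪ ρ ∈ K.faces := (Finset.mem_filter.1 hs).2
        refine ⟨∅, Finset.empty_subset _, ρ ∩ σ, ?_, ρ \ σ, ?_, ?_⟩
        · refine ⟨Finset.inter_subset_right, fun hsub => hτs ?_⟩
          have h1 : σ ⊆ τ := fun x hx => hρ (Finset.mem_inter.1 (hsub hx)).1
          refine Finset.mem_filter.2 ⟨hτK, ?_⟩
          rwa [Finset.union_eq_right.2 h1]
        · refine Finset.mem_filter.2 ⟨K.down_closed hρK Finset.sdiff_subset, ?_, ?_⟩
          · rwa [Finset.union_sdiff_self_eq_union]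
          · exact Finset.inter_sdiff_self σ ρ
        · ext x; by_cases hx : x ∈ σ <;> simp [hx]
      · exact Finset.mem_union_left _ (Finset.mem_sdiff.2 ⟨hρK, hs⟩)
    · refine Finset.mem_union_right _ ((mem_cone_boundary_link K σ a _).2 ?_)
      obtain ⟨u, hu, s, hs, t, ht, rfl⟩ := (mem_cone_boundary_link K σ a _).1 h
      obtain ⟨htK, htu, htd⟩ := Finset.mem_filter.1 ht
      refine ⟨ρ ∩ u, Finset.inter_subset_right.trans hu, ρ ∩ s,
        lt_of_le_of_lt Finset.inter_subset_right hs, ρ ∩ t, ?_, ?_⟩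
      · refine Finset.mem_filter.2 ⟨K.down_closed htK Finset.inter_subset_right, ?_, ?_⟩
        · exact K.down_closed htu (Finset.union_subset_union_right Finset.inter_subset_right)
        · exact Finset.subset_empty.1
            ((Finset.inter_subset_inter_left Finset.inter_subset_right).trans htd.subset)
      · rw [← Finset.inter_union_distrib_left, ← Finset.inter_union_distrib_left]
        exact (Finset.inter_eq_left.2 hρ).symm

end Subdivision

section Bicomplex

variable {α : Type*} [LinearOrder α]

/-- The vertex set of `K`. -/
def vertices (K : FinComplex α) : Finset α := K.faces.biUnion id

/-- The simplices that generate the chain group: all of them (the empty simplex, of dimension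
`-1`, included) in the reduced case, the nonempty ones in the unreduced case. -/
def simplices (K : FinComplex α) (reduced : Bool) : Finset (Finset α) :=
  if reduced then K.faces else K.faces.erase ∅

/-- The pairs of simplices `σ ⊆ τ`. -/
def Flag (K : FinComplex α) (reduced : Bool) : Type _ :=
  {x : Finset α × Finset α //
    x.1 ∈ K.simplices reduced ∧ x.2 ∈ K.simplices reduced ∧ x.1 ⊆ x.2}

/-- The bicomplex `N^{*,*}(K)` (or its reduced version): the free abelian group on the
`σ ⊗ τ` with `σ ⊆ τ`, where every simplex stands for the chain simplex that lists its vertices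
in increasing order. -/
abbrev N (K : FinComplex α) (reduced : Bool) : Type _ := K.Flag reduced →₀ ℤ

/-- The generator `σ ⊗ τ` of the bicomplex; it is `0` if `σ` or `τ` is not a simplex of the
relevant kind. -/
noncomputable def gen (K : FinComplex α) (reduced : Bool) (σ τ : Finset α) : K.N reduced :=
  if h : σ ∈ K.simplices reduced ∧ τ ∈ K.simplices reduced ∧ σ ⊆ τ then
    Finsupp.single ⟨(σ, τ), h⟩ 1 else 0

/-- The sign `(-1)^#{u ∈ τ | u < v}`. For `v ∉ τ` the chain simplex `(v) * τ` is this sign times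
the increasingly ordered `τ ∪ {v}`, and the coefficient of `τ` in `d (τ ∪ {v})` is the same sign. -/
def vsign (τ : Finset α) (v : α) : ℤ := (-1) ^ (τ.filter (· < v)).card

/-- The first part `d ⊗ 1` of the differential, of bidegree `(-1, 0)`:
`σ ⊗ τ ↦ ∑_{v ∈ σ} ± (σ ∖ v) ⊗ τ`. In the unreduced case `d (v) = 0`, as then `gen ∅ τ = 0`. -/
noncomputable def dLeft (K : FinComplex α) (reduced : Bool) : K.N reduced →ₗ[ℤ] K.N reduced :=
  Finsupp.linearCombination ℤ fun x : K.Flag reduced =>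
    ∑ v ∈ x.1.1, vsign x.1.1 v • K.gen reduced (x.1.1.erase v) x.1.2

/-- The second part `± 1 ⊗ δ` of the differential, of bidegree `(0, 1)`:
`σ ⊗ τ ↦ (-1)^|σ| ∑_v σ ⊗ ((v) * τ)`. -/
noncomputable def dRight (K : FinComplex α) (reduced : Bool) : K.N reduced →ₗ[ℤ] K.N reduced :=
  Finsupp.linearCombination ℤ fun x : K.Flag reduced =>
    (-1 : ℤ) ^ x.1.1.card •
      ∑ v ∈ K.vertices \ x.1.2, vsign x.1.2 v • K.gen reduced x.1.1 (insert v x.1.2)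

/-- The total differential `Δ (σ ⊗ τ) = dσ ⊗ τ + (-1)^|σ| σ ⊗ δτ`. -/
noncomputable def Delta (K : FinComplex α) (reduced : Bool) : K.N reduced →ₗ[ℤ] K.N reduced :=
  K.dLeft reduced + K.dRight reduced

/-- The part `N^{i,j}` of bidegree `(i, j)`, generated by the `σ ⊗ τ` with `dim σ = i` and
`dim τ = j`. -/
noncomputable def piece (K : FinComplex α) (reduced : Bool) (i j : ℤ) : Submodule ℤ (K.N reduced) :=
  Submodule.span ℤ
    {x | ∃ σ τ : Finset α, (σ.card : ℤ) - 1 = i ∧ (τ.card : ℤ) - 1 = j ∧ x = K.gen reduced σ τ}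

/-- The part `N_{i,j} = Hom(N^{i,j}, ℤ)` of the dual bicomplex, as the group of the functionals
that vanish on all other bidegrees. -/
noncomputable def dualPiece (K : FinComplex α) (reduced : Bool) (i j : ℤ) :
    Submodule ℤ (Module.Dual ℤ (K.N reduced)) :=
  ⨅ (k : ℤ) (l : ℤ) (_ : (k, l) ≠ (i, j)), (K.piece reduced k l).dualAnnihilator

end Bicomplex

end FinComplex

namespace Homeology

section SpectralSequence

variable {M : Type*} [AddCommGroup M]

/-- For a cochain complex (with differential `D`) and an increasing filtration, given by the groups
`F p n` of the elements of filtration `p` and degree `n`, the group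
`Z_r^p = {x ∈ F^p | D x ∈ F^{p-r}}` in degree `n`. -/
def Z (D : M →ₗ[ℤ] M) (F : ℤ → ℤ → Submodule ℤ M) (r p n : ℤ) : Submodule ℤ M :=
  F p n ⊓ (F (p - r) (n + 1)).comap D

/-- The `E_r`-term of the spectral sequence of the filtered complex, in filtration `p` and total
degree `n`: `E_r^p = Z_r^p / (Z_{r-1}^{p-1} + D Z_{r-1}^{p+r-1})`. -/
abbrev E (D : M →ₗ[ℤ] M) (F : ℤ → ℤ → Submodule ℤ M) (r p n : ℤ) : Type _ :=
  ↥(Z D F r p n) ⧸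
    (Z D F (r - 1) (p - 1) n ⊔ (Z D F (r - 1) (p + r - 1) (n - 1)).map D).comap
      (Z D F r p n).subtype

/-- The subgroup `P ⊗ G` of `M ⊗ G`, for a subgroup `P` of `M`. -/
def withCoeff (G : Type*) [AddCommGroup G] (P : Submodule ℤ M) : Submodule ℤ (M ⊗[ℤ] G) :=
  LinearMap.range (P.subtype.rTensor G)

end SpectralSequence

variable {α : Type*} [LinearOrder α]

/-- The filtration `F^p = ⨁_{i ≤ p} N^{i,*}(K; G)` of the total complex, in degree `n = j - i`. -/
noncomputable def upFiltration (K : FinComplex α) (reduced : Bool) (G : Type*) [AddCommGroup G] (p n : ℤ) :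
    Submodule ℤ (K.N reduced ⊗[ℤ] G) :=
  ⨆ (i : ℤ) (_ : i ≤ p), withCoeff G (K.piece reduced i (i + n))

/-- The filtration `F_p = ⨁_{i ≥ p} N_{i,*}(K; G)` of the dual total complex, made increasing by
putting `s = -p`. The dual differential lowers `j - i` by one, so `n = i - j` is the
cohomological degree. -/
noncomputable def downFiltration (K : FinComplex α) (reduced : Bool) (G : Type*) [AddCommGroup G] (s n : ℤ) :
    Submodule ℤ (Module.Dual ℤ (K.N reduced) ⊗[ℤ] G) :=
  ⨆ (i : ℤ) (_ : -s ≤ i), withCoeff G (K.dualPiece reduced i (i - n))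

/-- The cohomeology group `H^{p,q}(K; G)` (its reduced version if `reduced = true`): the `E_2`-term
at `(p, q)` of the spectral sequence of `(N^{*,*}(K) ⊗ G, Δ)`; the total degree is `q - p`. -/
abbrev CohomeologyGroup (K : FinComplex α) (reduced : Bool) (G : Type*) [AddCommGroup G] (p q : ℤ) :
    Type _ :=
  E ((K.Delta reduced).rTensor G) (upFiltration K reduced G) 2 p (q - p)

/-- The homeology group `H_{p,q}(K; G)` (its reduced version if `reduced = true`): the `E^2`-term
at `(p, q)` of the spectral sequence of the dual complex `(Hom(N^{*,*}(K), ℤ) ⊗ G, Δ^*)`. -/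
abbrev HomeologyGroup (K : FinComplex α) (reduced : Bool) (G : Type*) [AddCommGroup G] (p q : ℤ) :
    Type _ :=
  E ((K.Delta reduced).dualMap.rTensor G) (downFiltration K reduced G) 2 (-p) (p - q)

end Homeology

set_option linter.unusedSectionVars false

/-! Call a pair ρ ⊗ τ mixed if ρ is a simplex of K', τ is a simplex of K, and ρ lies in τ
geometrically, i.e. `carrier s a ρ ⊆ τ`. The mixed pairs span a bicomplex M between N(K') and N(K).
There are deformation retractions of N(K') onto M and of M onto N(K) whose homotopies raise the
filtration by at most one. Such a homotopy is invisible in E_2 (`FilteredRetract.equivE`). Filtered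
retractions compose, dualize and can be tensored with G, so a single one settles both theories for
all coefficients.

Three maps of cochains do the work: `coarsen`, the transpose of subdivision; `pullback` along the
simplicial map K' → K that sends the apex a to a vertex v of s; and `contr`, which deletes v from
the simplices through a. On K, coarsening after pulling back is the identity (`coarsen_pullback`).
On K', pulling back after coarsening is homotopic to the identity via `contr` (`pullback_coarsen`).

From M to N(K), the transposes of these maps act on the first factor, with one fixed v. The homotopy
does not change carriers, so it stays inside M. It raises the dimension of the first factor by one,
which is just what E_2 tolerates (`nonempty_retract_mixed`).

From N(K') to M, the maps act on the second factor and must preserve ρ ⊆ τ, which forces v ∉ ρ.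
Since s is not a face of any simplex of K', every ρ misses some vertex v(ρ) of s. The choice of v(ρ)
is not compatible with passing to faces of ρ, so the retraction data fit together only up to terms
that involve d on the first factor. These terms lower the filtration, hence are nilpotent, and the
perturbation lemma `exists_filteredRetract_of_nilpotent` removes them
(`nonempty_retract_subdivision`). -/

namespace Homeology

/-! ### Filtered deformation retractions and the perturbation lemma -/

section Retract

variable {M M' : Type*} [AddCommGroup M] [AddCommGroup M']

/-- A deformation retraction of the filtered complex `M` onto `M'`, whose homotopy raises the
filtration by at most one. It induces isomorphisms of the `E_2`-terms. -/
structure FilteredRetract (D : M →ₗ[ℤ] M) (F : ℤ → ℤ → Submodule ℤ M)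
    (D' : M' →ₗ[ℤ] M') (F' : ℤ → ℤ → Submodule ℤ M') where
  proj : M →ₗ[ℤ] M'
  incl : M' →ₗ[ℤ] M
  htpy : M →ₗ[ℤ] M
  sq_zero : D ∘ₗ D = 0
  proj_comm : proj ∘ₗ D = D' ∘ₗ proj
  incl_comm : incl ∘ₗ D' = D ∘ₗ incl
  proj_incl : proj ∘ₗ incl = LinearMap.id
  incl_proj : incl ∘ₗ proj = LinearMap.id + (D ∘ₗ htpy + htpy ∘ₗ D)
  proj_le : ∀ p n x, x ∈ F p n → proj x ∈ F' p n
  incl_le : ∀ p n x, x ∈ F' p n → incl x ∈ F p n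
  htpy_le : ∀ p n x, x ∈ F p n → htpy x ∈ F (p + 1) (n - 1)

variable {D : M →ₗ[ℤ] M} {F : ℤ → ℤ → Submodule ℤ M}
  {D' : M' →ₗ[ℤ] M'} {F' : ℤ → ℤ → Submodule ℤ M'}

theorem map_mem_Z {φ : M →ₗ[ℤ] M'} (hc : φ ∘ₗ D = D' ∘ₗ φ)
    (hF : ∀ p n x, x ∈ F p n → φ x ∈ F' p n) (r p n : ℤ) :
    ∀ x ∈ Z D F r p n, φ x ∈ Z D' F' r p n := by
  rintro x ⟨h1, h2⟩
  refine ⟨hF _ _ _ h1, ?_⟩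
  have : D' (φ x) = φ (D x) := (LinearMap.congr_fun hc x).symm
  change D' (φ x) ∈ F' (p - r) (n + 1)
  rw [this]
  exact hF _ _ _ h2

/-- The map of `E_r`-terms induced by a map of filtered complexes. -/
def mapE {φ : M →ₗ[ℤ] M'} (hc : φ ∘ₗ D = D' ∘ₗ φ)
    (hF : ∀ p n x, x ∈ F p n → φ x ∈ F' p n) (r p n : ℤ) : E D F r p n →ₗ[ℤ] E D' F' r p n :=
  Submodule.mapQ _ _ (φ.restrict (map_mem_Z hc hF r p n)) <| by
    intro x hx
    obtain ⟨y, hy, z, ⟨w, hw, rfl⟩, hyz⟩ := Submodule.mem_sup.1 (Submodule.mem_comap.1 hx)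
    refine Submodule.mem_sup.2 ⟨φ y, map_mem_Z hc hF _ _ _ _ hy, D' (φ w),
      ⟨φ w, map_mem_Z hc hF _ _ _ _ hw, rfl⟩, ?_⟩
    have h1 : D' (φ w) = φ (D w) := (LinearMap.congr_fun hc w).symm
    have h2 : (φ.restrict (map_mem_Z hc hF r p n) x : M') = φ x := rfl
    rw [h1, ← map_add, hyz]
    rfl

theorem mapE_mk {φ : M →ₗ[ℤ] M'} (hc : φ ∘ₗ D = D' ∘ₗ φ)
    (hF : ∀ p n x, x ∈ F p n → φ x ∈ F' p n) (r p n : ℤ) (x : Z D F r p n) :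
    mapE hc hF r p n (Submodule.Quotient.mk x) =
      Submodule.Quotient.mk (φ.restrict (map_mem_Z hc hF r p n) x) := rfl

/-- A filtered retract has the same `E_2`-term. -/
noncomputable def FilteredRetract.equivE (R : FilteredRetract D F D' F')
    (hmono : ∀ n, Monotone fun p => F p n) (p n : ℤ) :
    E D F 2 p n ≃+ E D' F' 2 p n where
  toFun := mapE R.proj_comm R.proj_le 2 p n
  invFun := mapE R.incl_comm R.incl_le 2 p n
  map_add' := map_add _
  left_inv := by
    intro x
    obtain ⟨⟨x, h1, h2⟩, rfl⟩ := Submodule.Quotient.mk_surjective _ x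
    rw [mapE_mk, mapE_mk, Submodule.Quotient.eq]
    have hip := LinearMap.congr_fun R.incl_proj
    have hsq := LinearMap.congr_fun R.sq_zero
    simp only [LinearMap.comp_apply, LinearMap.add_apply, LinearMap.id_apply,
      LinearMap.zero_apply] at hip hsq
    have hic := LinearMap.congr_fun R.incl_comm
    have hpc := LinearMap.congr_fun R.proj_comm
    simp only [LinearMap.comp_apply] at hic hpc
    have h2' : D x ∈ F (p - 2) (n + 1) := h2
    have hD : R.htpy (D x) ∈ F (p - 1) n := by
      have := R.htpy_le _ _ _ h2'
      simpa [show p - 2 + 1 = p - 1 by ring] using this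
    have hx : R.incl (R.proj x) ∈ F p n := R.incl_le _ _ _ (R.proj_le _ _ _ h1)
    -- With h the homotopy, the difference to be killed is hDx + Dhx. As Dx has filtration p - 2,
    -- hDx lies in Z_1^{p-1}; and hx lies in Z_1^{p+1}. These are the two parts of the denominator
    -- of E_2.
    refine Submodule.mem_sup.2 ⟨R.htpy (D x), ⟨by simpa using hD, ?_⟩, D (R.htpy x),
      ⟨R.htpy x, ⟨?_, ?_⟩, rfl⟩, ?_⟩
    · change D (R.htpy (D x)) ∈ F (p - 1 - (2 - 1)) (n + 1)
      have h3 : D (R.htpy (D x)) = R.incl (R.proj (D x)) - D x := by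
        rw [hip, hsq]; simp
      rw [h3, show p - 1 - (2 - 1) = p - 2 by ring]
      exact Submodule.sub_mem _ (R.incl_le _ _ _ (R.proj_le _ _ _ h2')) h2'
    · have := R.htpy_le _ _ _ h1
      simpa [show p + 2 - 1 = p + 1 by ring] using this
    · change D (R.htpy x) ∈ F (p + 2 - 1 - (2 - 1)) (n - 1 + 1)
      have h3 : D (R.htpy x) = R.incl (R.proj x) - x - R.htpy (D x) := by
        rw [hip]; abel
      rw [h3, show p + 2 - 1 - (2 - 1) = p by ring, show n - 1 + 1 = n by ring]
      exact Submodule.sub_mem _ (Submodule.sub_mem _ hx h1) (hmono n (by simp) hD)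
    · change _ = R.incl (R.proj x) - x
      rw [hip]; abel
  right_inv := by
    intro x
    obtain ⟨⟨x, h1, h2⟩, rfl⟩ := Submodule.Quotient.mk_surjective _ x
    rw [mapE_mk, mapE_mk]
    congr 1
    exact Subtype.ext (LinearMap.congr_fun R.proj_incl x)

/-- Filtered retractions compose. -/
def FilteredRetract.trans {M'' : Type*} [AddCommGroup M''] {D'' : M'' →ₗ[ℤ] M''}
    {F'' : ℤ → ℤ → Submodule ℤ M''} (R : FilteredRetract D F D' F')
    (R' : FilteredRetract D' F' D'' F'') : FilteredRetract D F D'' F'' where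
  proj := R'.proj ∘ₗ R.proj
  incl := R.incl ∘ₗ R'.incl
  htpy := R.htpy + R.incl ∘ₗ R'.htpy ∘ₗ R.proj
  sq_zero := R.sq_zero
  proj_comm := by
    rw [LinearMap.comp_assoc, R.proj_comm, ← LinearMap.comp_assoc, R'.proj_comm,
      LinearMap.comp_assoc]
  incl_comm := by
    rw [LinearMap.comp_assoc, R'.incl_comm, ← LinearMap.comp_assoc, R.incl_comm,
      LinearMap.comp_assoc]
  proj_incl := by
    ext x
    have h1 := LinearMap.congr_fun R.proj_incl (R'.incl x)
    have h2 := LinearMap.congr_fun R'.proj_incl x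
    simp only [LinearMap.comp_apply, LinearMap.id_apply] at h1 h2 ⊢
    rw [h1, h2]
  incl_proj := by
    ext x
    have h1 := LinearMap.congr_fun R.incl_proj x
    have h2 := LinearMap.congr_fun R'.incl_proj (R.proj x)
    have h3 := LinearMap.congr_fun R.proj_comm x
    have h4 := LinearMap.congr_fun R.incl_comm (R'.htpy (R.proj x))
    simp only [LinearMap.comp_apply, LinearMap.id_apply, LinearMap.add_apply, map_add]
      at h1 h2 h3 h4 ⊢
    rw [h2, map_add, h1, h3, map_add, h4]
    abel
  proj_le p n x hx := R'.proj_le _ _ _ (R.proj_le _ _ _ hx)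
  incl_le p n x hx := R.incl_le _ _ _ (R'.incl_le _ _ _ hx)
  htpy_le p n x hx := add_mem (R.htpy_le _ _ _ hx)
    (R.incl_le _ _ _ (R'.htpy_le _ _ _ (R.proj_le _ _ _ hx)))

theorem withCoeff_le_iff (G : Type*) [AddCommGroup G] {P : Submodule ℤ M}
    {Q : Submodule ℤ (M ⊗[ℤ] G)} :
    withCoeff G P ≤ Q ↔ ∀ x ∈ P, ∀ g : G, x ⊗ₜ[ℤ] g ∈ Q := by
  constructor
  · intro h x hx g
    exact h ⟨(⟨x, hx⟩ : P) ⊗ₜ g, rfl⟩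
  · rintro h _ ⟨t, rfl⟩
    induction t with
    | zero => exact (LinearMap.map_zero (P.subtype.rTensor G)).symm ▸ Q.zero_mem
    | tmul x g => exact h x x.2 g
    | add a b ha hb => exact (LinearMap.map_add (P.subtype.rTensor G) a b).symm ▸ add_mem ha hb

theorem tmul_mem_withCoeff (G : Type*) [AddCommGroup G] {P : Submodule ℤ M} {x : M} (hx : x ∈ P)
    (g : G) : x ⊗ₜ[ℤ] g ∈ withCoeff G P :=
  (withCoeff_le_iff G).1 le_rfl x hx g

theorem withCoeff_mono (G : Type*) [AddCommGroup G] {P Q : Submodule ℤ M} (h : P ≤ Q) :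
    withCoeff G P ≤ withCoeff G Q :=
  (withCoeff_le_iff G).2 fun _ hx g => tmul_mem_withCoeff G (h hx) g

theorem withCoeff_iSup (G : Type*) [AddCommGroup G] {ι : Sort*} (P : ι → Submodule ℤ M) :
    withCoeff G (⨆ i, P i) = ⨆ i, withCoeff G (P i) := by
  refine le_antisymm ((withCoeff_le_iff G).2 fun x hx g => ?_)
    (iSup_le fun i => withCoeff_mono G (le_iSup P i))
  have : (⨆ i, P i) ≤ (⨆ i, withCoeff G (P i)).comap ((TensorProduct.mk ℤ M G).flip g) :=
    iSup_le fun i y hy => (le_iSup (fun i => withCoeff G (P i)) i) (tmul_mem_withCoeff G hy g)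
  exact this hx

/-- `withCoeff` is an image, so no exactness of the tensor product enters. -/
theorem rTensor_mem_withCoeff (G : Type*) [AddCommGroup G] {P : Submodule ℤ M}
    {Q : Submodule ℤ M'} {φ : M →ₗ[ℤ] M'} (h : ∀ x ∈ P, φ x ∈ Q) :
    ∀ t ∈ withCoeff G P, φ.rTensor G t ∈ withCoeff G Q := by
  have : withCoeff G P ≤ (withCoeff G Q).comap (φ.rTensor G) :=
    (withCoeff_le_iff G).2 fun x hx g => tmul_mem_withCoeff G (h x hx) g
  exact this

/-- Tensoring a filtered retract with a coefficient group. -/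
noncomputable def FilteredRetract.rTensor (R : FilteredRetract D F D' F') (G : Type*)
    [AddCommGroup G] :
    FilteredRetract (D.rTensor G) (fun p n => withCoeff G (F p n))
      (D'.rTensor G) (fun p n => withCoeff G (F' p n)) where
  proj := R.proj.rTensor G
  incl := R.incl.rTensor G
  htpy := R.htpy.rTensor G
  sq_zero := (LinearMap.rTensor_comp G D D).symm.trans
    ((congrArg _ R.sq_zero).trans (LinearMap.rTensor_zero G))
  proj_comm := (LinearMap.rTensor_comp G _ _).symm.trans
    ((congrArg _ R.proj_comm).trans (LinearMap.rTensor_comp G _ _))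
  incl_comm := (LinearMap.rTensor_comp G _ _).symm.trans
    ((congrArg _ R.incl_comm).trans (LinearMap.rTensor_comp G _ _))
  proj_incl := (LinearMap.rTensor_comp G _ _).symm.trans
    ((congrArg _ R.proj_incl).trans (LinearMap.rTensor_id G _))
  incl_proj := by
    refine (LinearMap.rTensor_comp G _ _).symm.trans ((congrArg _ R.incl_proj).trans ?_)
    refine (LinearMap.rTensor_add G _ _).trans ?_
    refine congrArg₂ _ (LinearMap.rTensor_id G _) ?_
    refine (LinearMap.rTensor_add G _ _).trans ?_
    exact congrArg₂ _ (LinearMap.rTensor_comp G _ _) (LinearMap.rTensor_comp G _ _)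
  proj_le p n := rTensor_mem_withCoeff G (R.proj_le p n)
  incl_le p n := rTensor_mem_withCoeff G (R.incl_le p n)
  htpy_le p n := rTensor_mem_withCoeff G (R.htpy_le p n)

/-- The perturbation lemma: if `i` and `H` make `M'` a deformation retract of `M` up to terms that
lower the filtration, then they can be corrected to a filtered retraction. -/
theorem exists_filteredRetract_of_nilpotent {g : M →ₗ[ℤ] M'} {i : M' →ₗ[ℤ] M} {H : M →ₗ[ℤ] M}
    (hmono : ∀ n, Monotone fun p => F p n)
    (hD : D ∘ₗ D = 0) (hg : g ∘ₗ D = D' ∘ₗ g) (hgi : g ∘ₗ i = LinearMap.id) (hgH : g ∘ₗ H = 0)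
    (hDF : ∀ p n x, x ∈ F p n → D x ∈ F p (n + 1))
    (hDF' : ∀ p n x, x ∈ F' p n → D' x ∈ F' p (n + 1))
    (hgF : ∀ p n x, x ∈ F p n → g x ∈ F' p n) (hiF : ∀ p n x, x ∈ F' p n → i x ∈ F p n)
    (hHF : ∀ p n x, x ∈ F p n → H x ∈ F p (n - 1))
    (hnil : IsNilpotent (i ∘ₗ g - D ∘ₗ H - H ∘ₗ D - LinearMap.id : Module.End ℤ M)) :
    Nonempty (FilteredRetract D F D' F') := by
  obtain ⟨N, hN⟩ := hnil
  set ν : Module.End ℤ M := i ∘ₗ g - D ∘ₗ H - H ∘ₗ D - LinearMap.id with hν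
  have hνF : ∀ p n x, x ∈ F p n → ν x ∈ F p n := by
    intro p n x hx
    have h1 : D (H x) ∈ F p n := by
      have := hDF _ _ _ (hHF _ _ _ hx); simpa using this
    have h2 : H (D x) ∈ F p n := by
      have := hHF _ _ _ (hDF _ _ _ hx); simpa using this
    exact sub_mem (sub_mem (sub_mem (hiF _ _ _ (hgF _ _ _ hx)) h1) h2) hx
  -- The finite geometric series in -ν inverts 1 + ν = ig - DH - HD and preserves the filtration.
  obtain ⟨Q, hQ1, hQ2, hQF⟩ : ∃ Q : Module.End ℤ M, (1 + ν) * Q = 1 ∧ Q * (1 + ν) = 1 ∧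
      ∀ p n x, x ∈ F p n → Q x ∈ F p n := by
    have hpow : ∀ k p n, ∀ x ∈ F p n, ((-ν) ^ k) x ∈ F p n := by
      intro k p n
      induction k with
      | zero => intro x hx; simpa using hx
      | succ k ih =>
        intro x hx
        have : ((-ν) ^ (k + 1)) x = (-ν) (((-ν) ^ k) x) := by rw [pow_succ']; rfl
        rw [this]
        exact neg_mem (hνF _ _ _ (ih x hx))
    refine ⟨∑ k ∈ Finset.range N, (-ν) ^ k, ?_, ?_, ?_⟩
    · have := mul_neg_geom_sum (-ν) N
      rwa [sub_neg_eq_add, neg_pow, hN, mul_zero, sub_zero] at this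
    · have := geom_sum_mul_neg (-ν) N
      rwa [sub_neg_eq_add, neg_pow, hN, mul_zero, sub_zero] at this
    · intro p n x hx
      rw [LinearMap.sum_apply]
      exact sum_mem fun k _ => hpow k p n x hx
  have hU : (1 : Module.End ℤ M) + ν = i ∘ₗ g - D ∘ₗ H - H ∘ₗ D := by
    rw [hν]; change LinearMap.id + _ = _; abel
  have hD' := LinearMap.congr_fun hD
  have hg' := LinearMap.congr_fun hg
  have hgi' := LinearMap.congr_fun hgi
  have hgH' := LinearMap.congr_fun hgH
  have hU1 : ∀ x, i (g (Q x)) - D (H (Q x)) - H (D (Q x)) = x := fun x => by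
    have := LinearMap.congr_fun hQ1 x
    rw [hU] at this
    exact this
  have hU2 : ∀ x, Q (i (g x)) - Q (D (H x)) - Q (H (D x)) = x := fun x => by
    have := LinearMap.congr_fun hQ2 x
    rw [hU] at this
    simpa using this
  simp only [LinearMap.comp_apply, LinearMap.id_apply, LinearMap.zero_apply] at hD' hg' hgi' hgH'
  -- Equivalently g(1 + ν) = g, which uses gi = 1, gH = 0 and that g commutes with the
  -- differentials.
  have hgQ : ∀ x, g (Q x) = g x := fun x => by
    have := congrArg g (hU1 x)
    simpa [hgi', hg', hgH'] using this
  -- The commutator of D with 1 + ν is (Di - iD')g. Multiplying by Q on both sides and using gQ = g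
  -- yields the commutator with Q.
  have hQD : ∀ x, Q (D x) = D (Q x) + Q (D (i (g x)) - i (D' (g x))) := fun x => by
    have h1 := congrArg D (hU1 x)
    have h2 := hU2 (D (Q x))
    have h3 : Q (D x) = Q (D (i (g (Q x)))) - Q (D (H (D (Q x)))) := by
      rw [← h1]; simp [hD']
    rw [h3, hgQ]
    conv_rhs => lhs; rw [← h2]
    simp [hD', hg', hgQ]
  -- HQ is the corrected homotopy. The term added to i repairs its failure to commute with the
  -- differentials, and g kills that term because gH = 0.
  refine ⟨{
    proj := g
    incl := i + H ∘ₗ Q ∘ₗ (D ∘ₗ i - i ∘ₗ D')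
    htpy := H ∘ₗ Q
    sq_zero := hD
    proj_comm := hg
    incl_comm := ?_
    proj_incl := ?_
    incl_proj := ?_
    proj_le := hgF
    incl_le := ?_
    htpy_le := fun p n x hx => hmono _ (by simp) (hHF _ _ _ (hQF _ _ _ hx)) }⟩
  all_goals
    have hmain : ∀ x, i (g x) + H (Q (D (i (g x)) - i (D' (g x)))) =
        x + (D (H (Q x)) + H (Q (D x))) := fun x => by
      have h1 := hU1 x
      rw [hgQ] at h1
      rw [hQD, map_add]
      conv_rhs => lhs; rw [← h1]
      abel
  · ext y
    have h1 := hmain (i y)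
    have h2 := hmain (D (i y))
    rw [hg', hgi'] at h2
    rw [hgi'] at h1
    have h3 := congrArg D h1
    simp only [LinearMap.comp_apply, LinearMap.add_apply, LinearMap.sub_apply]
    rw [h2, h3]
    simp [hD']
  · ext y
    simp [hgi', hgH']
  · ext x
    simpa using hmain x
  · intro p n y hy
    refine add_mem (hiF _ _ _ hy) ?_
    have h1 : D (i y) - i (D' y) ∈ F p (n + 1) :=
      sub_mem (hDF _ _ _ (hiF _ _ _ hy)) (hiF _ _ _ (hDF' _ _ _ hy))
    have := hHF _ _ _ (hQF _ _ _ h1)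
    simpa using this

end Retract

/-! ### Filtrations of a free group with bigraded basis, and their duals -/

section Bigraded

variable {I J : Type*} {a b : I → ℤ} {a' b' : J → ℤ}

/-- The filtration of the free group on a basis with bidegrees `(a, b)`: in degree `n`, the group
`F^p` is generated by the basis elements with `a ≤ p` and `b - a = n`. -/
def basisFiltration (a b : I → ℤ) (p n : ℤ) : Submodule ℤ (I →₀ ℤ) :=
  Finsupp.supported ℤ ℤ {x | a x ≤ p ∧ b x - a x = n}

/-- The dual filtration: in degree `n`, the functionals that vanish on the basis elements other
than those with `-s ≤ a` and `a - b = n`. -/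
def dualBasisFiltration (a b : I → ℤ) (s n : ℤ) : Submodule ℤ (Module.Dual ℤ (I →₀ ℤ)) where
  carrier := {ξ | ∀ x, ξ (Finsupp.single x 1) ≠ 0 → -s ≤ a x ∧ a x - b x = n}
  zero_mem' x h := (h rfl).elim
  add_mem' {ξ η} hξ hη x h := by
    by_cases h1 : ξ (Finsupp.single x 1) = 0
    · exact hη x fun h2 => h (by simp [h1, h2])
    · exact hξ x h1
  smul_mem' c ξ hξ x h := hξ x fun h1 => h (by simp [h1])

theorem basisFiltration_mono (a b : I → ℤ) (n : ℤ) : Monotone fun p => basisFiltration a b p n :=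
  fun _ _ h => Finsupp.supported_mono fun _ hx => ⟨hx.1.trans h, hx.2⟩

theorem dualBasisFiltration_mono (a b : I → ℤ) (n : ℤ) :
    Monotone fun s => dualBasisFiltration a b s n :=
  fun _ _ h _ hξ x hx => ⟨(neg_le_neg h).trans (hξ x hx).1, (hξ x hx).2⟩

theorem single_mem_basisFiltration (a b : I → ℤ) (x : I) :
    Finsupp.single x 1 ∈ basisFiltration a b (a x) (b x - a x) :=
  Finsupp.single_mem_supported ℤ _ ⟨le_rfl, rfl⟩

/-- A functional φ*ξ that is nonzero at x has ξ nonzero at some basis element in the support of φ x,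
whose bidegree constrains that of x. Because the dual filtration is indexed by s = -p, the shift k
keeps its sign, so the bound on a homotopy survives dualizing. -/
theorem dualMap_mem_dualBasisFiltration {φ : (I →₀ ℤ) →ₗ[ℤ] (J →₀ ℤ)} {k m : ℤ}
    (hφ : ∀ p n, ∀ x ∈ basisFiltration a b p n, φ x ∈ basisFiltration a' b' (p + k) (n + m))
    (s n : ℤ) (ξ : Module.Dual ℤ (J →₀ ℤ)) (hξ : ξ ∈ dualBasisFiltration a' b' s n) :
    φ.dualMap ξ ∈ dualBasisFiltration a b (s + k) (n + m) := by
  intro x hx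
  have h1 := hφ _ _ _ (single_mem_basisFiltration a b x)
  set y := φ (Finsupp.single x 1) with hy
  have h2 : ξ y ≠ 0 := hx
  rw [← Finsupp.sum_single y, map_finsuppSum] at h2
  obtain ⟨z, hz, hz0⟩ := Finset.exists_ne_zero_of_sum_ne_zero h2
  have h3 : ξ (Finsupp.single z 1) ≠ 0 := by
    intro h0
    apply hz0
    change ξ (Finsupp.single z (y z)) = 0
    rw [← mul_one (y z), ← smul_eq_mul, ← Finsupp.smul_single, map_smul, h0, smul_zero]
  have h4 := (Finsupp.mem_supported ℤ y).1 h1 hz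
  have h5 := hξ z h3
  simp only [Set.mem_ofPred_eq] at h4
  omega

theorem isNilpotent_of_lowers_filtration [Finite I] {ν : Module.End ℤ (I →₀ ℤ)}
    (hν : ∀ p n, ∀ x ∈ basisFiltration a b p n, ν x ∈ basisFiltration a b (p + -1) n) :
    IsNilpotent ν := by
  obtain ⟨B, hB⟩ := (Set.finite_range a).bddAbove
  obtain ⟨C, hC⟩ := (Set.finite_range a).bddBelow
  have hpow : ∀ (k : ℕ) p n, ∀ x ∈ basisFiltration a b p n,
      (ν ^ k) x ∈ basisFiltration a b (p - k) n := by
    intro k p n x hx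
    induction k with
    | zero => simpa using hx
    | succ k ih =>
      have h1 : (ν ^ (k + 1)) x = ν ((ν ^ k) x) := by rw [pow_succ']; rfl
      rw [h1, show p - ((k + 1 : ℕ) : ℤ) = p - k + -1 by push_cast; ring]
      exact hν _ _ _ ih
  -- All filtration degrees lie between C and B, so after B - C + 1 drops nothing is left.
  refine ⟨(B - C + 1).toNat, Finsupp.lhom_ext' fun x => LinearMap.ext_ring ?_⟩
  have h1 := hpow (B - C + 1).toNat _ _ _ (single_mem_basisFiltration a b x)
  ext y
  by_contra h0
  have h2 := (Finsupp.mem_supported ℤ _).1 h1 (Finsupp.mem_support_iff.2 h0)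
  simp only [Set.mem_ofPred_eq] at h2
  have h3 := hB ⟨x, rfl⟩
  have h4 := hC ⟨y, rfl⟩
  have h5 := Int.self_le_toNat (B - C + 1)
  have h6 := h2.1
  omega

/-- The dual of a filtered retract. -/
noncomputable def FilteredRetract.dual {D : (I →₀ ℤ) →ₗ[ℤ] (I →₀ ℤ)}
    {D' : (J →₀ ℤ) →ₗ[ℤ] (J →₀ ℤ)}
    (R : FilteredRetract D (basisFiltration a b) D' (basisFiltration a' b')) :
    FilteredRetract D.dualMap (dualBasisFiltration a b) D'.dualMap
      (dualBasisFiltration a' b') where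
  proj := R.incl.dualMap
  incl := R.proj.dualMap
  htpy := R.htpy.dualMap
  sq_zero := by rw [LinearMap.dualMap_comp_dualMap, R.sq_zero]; ext ξ x; simp
  proj_comm := by rw [LinearMap.dualMap_comp_dualMap, ← R.incl_comm,
    LinearMap.dualMap_comp_dualMap]
  incl_comm := by rw [LinearMap.dualMap_comp_dualMap, ← R.proj_comm,
    LinearMap.dualMap_comp_dualMap]
  proj_incl := by rw [LinearMap.dualMap_comp_dualMap, R.proj_incl, LinearMap.dualMap_id]
  incl_proj := by
    rw [LinearMap.dualMap_comp_dualMap, R.incl_proj]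
    ext ξ x
    simp [add_comm]
  proj_le s n ξ hξ := by
    simpa using dualMap_mem_dualBasisFiltration (k := 0) (m := 0)
      (by simpa using R.incl_le) s n ξ hξ
  incl_le s n ξ hξ := by
    simpa using dualMap_mem_dualBasisFiltration (k := 0) (m := 0)
      (by simpa using R.proj_le) s n ξ hξ
  htpy_le s n ξ hξ := dualMap_mem_dualBasisFiltration (k := 1) (m := -1) R.htpy_le s n ξ hξ

end Bigraded

/-! ### The filtrations of the bicomplex in terms of flags -/

section Flags

variable {α : Type*} [LinearOrder α] (K : FinComplex α) (reduced : Bool)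

/-- The dimension of the first simplex of a flag. -/
def dimLeft (x : K.Flag reduced) : ℤ := (x.1.1.card : ℤ) - 1

/-- The dimension of the second simplex of a flag. -/
def dimRight (x : K.Flag reduced) : ℤ := (x.1.2.card : ℤ) - 1

instance finite_flag : Finite (K.Flag reduced) := by
  refine Set.Finite.subset
    ((K.simplices reduced ×ˢ K.simplices reduced : Finset _).finite_toSet) ?_
  rintro ⟨σ, τ⟩ ⟨h1, h2, -⟩
  simp [h1, h2]

theorem gen_flag (x : K.Flag reduced) :
    K.gen reduced x.1.1 x.1.2 = Finsupp.single x 1 := by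
  unfold FinComplex.gen
  exact dif_pos x.2

theorem single_mem_piece (x : K.Flag reduced) :
    Finsupp.single x 1 ∈ K.piece reduced (dimLeft K reduced x) (dimRight K reduced x) :=
  Submodule.subset_span ⟨x.1.1, x.1.2, rfl, rfl, (gen_flag K reduced x).symm⟩

theorem piece_le_supported (i j : ℤ) :
    K.piece reduced i j ≤
      Finsupp.supported ℤ ℤ {x | dimLeft K reduced x = i ∧ dimRight K reduced x = j} := by
  refine Submodule.span_le.2 ?_
  rintro _ ⟨σ, τ, hσ, hτ, rfl⟩
  unfold FinComplex.gen
  split_ifs with h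
  · exact Finsupp.single_mem_supported ℤ _ ⟨hσ, hτ⟩
  · exact Submodule.zero_mem _

theorem iSup_piece (p n : ℤ) :
    (⨆ (i : ℤ) (_ : i ≤ p), K.piece reduced i (i + n)) =
      basisFiltration (dimLeft K reduced) (dimRight K reduced) p n := by
  refine le_antisymm (iSup₂_le fun i hi => (piece_le_supported K reduced _ _).trans
    (Finsupp.supported_mono ?_)) ?_
  · rintro x ⟨h1, h2⟩
    simp only [Set.mem_ofPred_eq]
    omega
  · unfold basisFiltration
    rw [Finsupp.supported_eq_span_single, Submodule.span_le]
    rintro _ ⟨x, ⟨h1, h2⟩, rfl⟩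
    have h := single_mem_piece K reduced x
    rw [show dimRight K reduced x = dimLeft K reduced x + n by omega] at h
    exact (le_iSup₂ (f := fun (i : ℤ) (_ : i ≤ p) => K.piece reduced i (i + n)) _ h1) h

theorem iSup_dualPiece (s n : ℤ) :
    (⨆ (i : ℤ) (_ : -s ≤ i), K.dualPiece reduced i (i - n)) =
      dualBasisFiltration (dimLeft K reduced) (dimRight K reduced) s n := by
  refine le_antisymm (iSup₂_le fun i hi => ?_) ?_
  · intro ξ hξ x hx
    unfold FinComplex.dualPiece at hξ
    simp only [Submodule.mem_iInf] at hξ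
    by_contra hcon
    refine hx ((Submodule.mem_dualAnnihilator ξ).1 (hξ _ _ ?_) _ (single_mem_piece K reduced x))
    intro h
    simp only [Prod.mk.injEq] at h
    omega
  · intro ξ hξ
    classical
    have := Fintype.ofFinite (K.Flag reduced)
    -- There are finitely many flags, so the dual is spanned by coordinate functionals, each of
    -- which is bihomogeneous.
    have hsum : ξ = ∑ x : K.Flag reduced, ξ (Finsupp.single x 1) • Finsupp.lapply x := by
      ext y
      simp [Finsupp.single_apply]
    rw [hsum]
    refine sum_mem fun x _ => ?_
    by_cases hx : ξ (Finsupp.single x 1) = 0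
    · rw [hx, zero_smul]; exact Submodule.zero_mem _
    obtain ⟨h1, h2⟩ := hξ x hx
    refine Submodule.smul_mem _ _ ((le_iSup₂
      (f := fun (i : ℤ) (_ : -s ≤ i) => K.dualPiece reduced i (i - n)) _ h1) ?_)
    unfold FinComplex.dualPiece
    simp only [Submodule.mem_iInf]
    intro k l hkl
    rw [Submodule.mem_dualAnnihilator]
    intro y hy
    by_contra h0
    have hxy : x ∈ y.support := Finsupp.mem_support_iff.2 h0
    have h3 := (Finsupp.mem_supported ℤ y).1 (piece_le_supported K reduced k l hy) hxy
    simp only [Set.mem_ofPred_eq] at h3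
    apply hkl
    ext <;> simp <;> omega

theorem upFiltration_eq (G : Type*) [AddCommGroup G] :
    upFiltration K reduced G = fun p n =>
      withCoeff G (basisFiltration (dimLeft K reduced) (dimRight K reduced) p n) := by
  funext p n
  rw [← iSup_piece, withCoeff_iSup]
  simp_rw [withCoeff_iSup]
  rfl

theorem downFiltration_eq (G : Type*) [AddCommGroup G] :
    downFiltration K reduced G = fun s n =>
      withCoeff G (dualBasisFiltration (dimLeft K reduced) (dimRight K reduced) s n) := by
  funext s n
  rw [← iSup_dualPiece, withCoeff_iSup]
  simp_rw [withCoeff_iSup]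
  rfl

variable {K reduced} {K' : FinComplex α}

theorem nonempty_cohomeologyGroup_equiv
    (R : FilteredRetract (K'.Delta reduced)
      (basisFiltration (dimLeft K' reduced) (dimRight K' reduced)) (K.Delta reduced)
      (basisFiltration (dimLeft K reduced) (dimRight K reduced)))
    (G : Type*) [AddCommGroup G] (p q : ℤ) :
    Nonempty (CohomeologyGroup K' reduced G p q ≃+ CohomeologyGroup K reduced G p q) := by
  unfold CohomeologyGroup
  rw [upFiltration_eq, upFiltration_eq]
  exact ⟨(R.rTensor G).equivE
    (fun n _ _ h => withCoeff_mono G (basisFiltration_mono _ _ n h)) _ _⟩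

theorem nonempty_homeologyGroup_equiv
    (R : FilteredRetract (K'.Delta reduced)
      (basisFiltration (dimLeft K' reduced) (dimRight K' reduced)) (K.Delta reduced)
      (basisFiltration (dimLeft K reduced) (dimRight K reduced)))
    (G : Type*) [AddCommGroup G] (p q : ℤ) :
    Nonempty (HomeologyGroup K' reduced G p q ≃+ HomeologyGroup K reduced G p q) := by
  unfold HomeologyGroup
  rw [downFiltration_eq, downFiltration_eq]
  exact ⟨(R.dual.rTensor G).equivE
    (fun n _ _ h => withCoeff_mono G (dualBasisFiltration_mono _ _ n h)) _ _⟩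

end Flags

/-! ### Creation, annihilation and truncation operators on finite sets of vertices -/

section Operators

variable {α : Type*} [LinearOrder α]

open FinComplex

/-- The generator of the free group on all finite sets. -/
noncomputable def e (τ : Finset α) : Finset α →₀ ℤ := Finsupp.single τ 1

/-- The linear map with given values on the generators. -/
noncomputable def onBasis {M : Type*} [AddCommGroup M] (φ : Finset α → M) :
    (Finset α →₀ ℤ) →ₗ[ℤ] M :=
  Finsupp.linearCombination ℤ φ

@[simp] theorem onBasis_e {M : Type*} [AddCommGroup M] (φ : Finset α → M) (τ : Finset α) :
    onBasis φ (e τ) = φ τ := by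
  simp [onBasis, e]

theorem hom_ext_e {M : Type*} [AddCommGroup M] {φ ψ : (Finset α →₀ ℤ) →ₗ[ℤ] M}
    (h : ∀ τ, φ (e τ) = ψ (e τ)) : φ = ψ :=
  Finsupp.lhom_ext' fun τ => LinearMap.ext_ring (h τ)

/-- Creation of the vertex `w`: exterior multiplication by `w` from the left. -/
noncomputable def ins (w : α) : (Finset α →₀ ℤ) →ₗ[ℤ] (Finset α →₀ ℤ) :=
  onBasis fun τ => if w ∈ τ then 0 else vsign τ w • e (insert w τ)

/-- Annihilation of the vertex `w`, the transpose of `ins w`. -/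
noncomputable def del (w : α) : (Finset α →₀ ℤ) →ₗ[ℤ] (Finset α →₀ ℤ) :=
  onBasis fun τ => if w ∈ τ then vsign τ w • e (τ.erase w) else 0

theorem ins_e_of_mem {w : α} {τ : Finset α} (h : w ∈ τ) : ins w (e τ) = 0 := by simp [ins, h]

theorem ins_e_of_notMem {w : α} {τ : Finset α} (h : w ∉ τ) :
    ins w (e τ) = vsign τ w • e (insert w τ) := by simp [ins, h]

theorem del_e_of_mem {w : α} {τ : Finset α} (h : w ∈ τ) :
    del w (e τ) = vsign τ w • e (τ.erase w) := by simp [del, h]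

theorem del_e_of_notMem {w : α} {τ : Finset α} (h : w ∉ τ) : del w (e τ) = 0 := by simp [del, h]

theorem exists_ins_e (w : α) (τ : Finset α) : ∃ c : ℤ, ins w (e τ) = c • e (insert w τ) := by
  by_cases h : w ∈ τ
  · exact ⟨0, by simp [ins_e_of_mem h]⟩
  · exact ⟨_, ins_e_of_notMem h⟩

theorem exists_del_e (w : α) (τ : Finset α) : ∃ c : ℤ, del w (e τ) = c • e (τ.erase w) := by
  by_cases h : w ∈ τ
  · exact ⟨_, del_e_of_mem h⟩
  · exact ⟨0, by simp [del_e_of_notMem h]⟩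

theorem vsign_mul_self (τ : Finset α) (v : α) : vsign τ v * vsign τ v = 1 := by
  unfold vsign
  rw [← mul_pow]; simp

theorem vsign_insert {τ : Finset α} {w : α} (hw : w ∉ τ) (v : α) :
    vsign (insert w τ) v = (if w < v then -1 else 1) * vsign τ v := by
  unfold vsign
  rw [Finset.filter_insert]
  split_ifs with h
  · rw [Finset.card_insert_of_notMem (by simp [hw]), pow_succ]; ring
  · simp

theorem vsign_insert_self (τ : Finset α) (w : α) : vsign (insert w τ) w = vsign τ w := by
  unfold vsign
  rw [Finset.filter_insert]
  simp

theorem vsign_erase_self (τ : Finset α) (w : α) : vsign (τ.erase w) w = vsign τ w := by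
  by_cases h : w ∈ τ
  · conv_rhs => rw [← Finset.insert_erase h, vsign_insert_self]
  · rw [Finset.erase_eq_of_notMem h]

theorem ins_del_self (v : α) (τ : Finset α) : ins v (del v (e τ)) = if v ∈ τ then e τ else 0 := by
  split_ifs with h
  · rw [del_e_of_mem h, map_smul, ins_e_of_notMem (Finset.notMem_erase v τ), vsign_erase_self,
      Finset.insert_erase h, smul_smul, vsign_mul_self, one_smul]
  · rw [del_e_of_notMem h, map_zero]

theorem del_ins_self (v : α) (τ : Finset α) : del v (ins v (e τ)) = if v ∈ τ then 0 else e τ := by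
  split_ifs with h
  · rw [ins_e_of_mem h, map_zero]
  · rw [ins_e_of_notMem h, map_smul, del_e_of_mem (Finset.mem_insert_self v τ), vsign_insert_self,
      Finset.erase_insert h, smul_smul, vsign_mul_self, one_smul]

/-- The signs in the cochain identities below reduce to this relation together with `ins_del_of_ne`,
`ins_del_self` and `del_ins_self`, the canonical anticommutation relations. -/
theorem ins_ins (v w : α) (x : Finset α →₀ ℤ) : ins v (ins w x) = -ins w (ins v x) := by
  suffices h : ins v ∘ₗ ins w = -(ins w ∘ₗ ins v) from LinearMap.congr_fun h x
  refine hom_ext_e fun τ => ?_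
  simp only [LinearMap.comp_apply, LinearMap.neg_apply]
  by_cases hv : v ∈ τ
  · rw [ins_e_of_mem hv, map_zero, neg_zero]
    obtain ⟨c, hc⟩ := exists_ins_e w τ
    rw [hc, map_smul, ins_e_of_mem (by simp [hv]), smul_zero]
  by_cases hw : w ∈ τ
  · rw [ins_e_of_mem hw, map_zero, zero_eq_neg, ins_e_of_notMem hv, map_smul,
      ins_e_of_mem (by simp [hw]), smul_zero]
  rw [ins_e_of_notMem hv, ins_e_of_notMem hw, map_smul, map_smul]
  by_cases hvw : v = w
  · subst hvw
    rw [ins_e_of_mem (by simp), smul_zero, neg_zero]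
  rw [ins_e_of_notMem (by simp [hvw, hv]), ins_e_of_notMem (by simp [Ne.symm hvw, hw]),
    Finset.insert_comm, smul_smul, smul_smul, ← neg_smul, vsign_insert hw, vsign_insert hv]
  congr 1
  rcases lt_or_gt_of_ne hvw with h | h <;> simp [h, h.not_gt] <;> ring

theorem ins_del_of_ne {v w : α} (hvw : v ≠ w) (x : Finset α →₀ ℤ) :
    ins v (del w x) = -del w (ins v x) := by
  suffices h : ins v ∘ₗ del w = -(del w ∘ₗ ins v) from LinearMap.congr_fun h x
  refine hom_ext_e fun τ => ?_
  simp only [LinearMap.comp_apply, LinearMap.neg_apply]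
  by_cases hw : w ∈ τ
  swap
  · obtain ⟨c, hc⟩ := exists_ins_e v τ
    rw [del_e_of_notMem hw, hc, map_zero, map_smul, del_e_of_notMem (by simp [hvw.symm, hw])]
    simp
  by_cases hv : v ∈ τ
  · rw [ins_e_of_mem hv, del_e_of_mem hw, map_smul, ins_e_of_mem (by simp [hvw, hv])]
    simp
  have hv' : v ∉ τ.erase w := by simp [hv]
  have hw' : τ = insert w (τ.erase w) := (Finset.insert_erase hw).symm
  rw [ins_e_of_notMem hv, del_e_of_mem hw, map_smul, map_smul, ins_e_of_notMem hv',
    del_e_of_mem (by simp [hw]), smul_smul, smul_smul, ← neg_smul,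
    Finset.erase_insert_of_ne hvw, vsign_insert hv]
  congr 1
  conv_rhs => rw [show vsign τ v = vsign (insert w (τ.erase w)) v by rw [← hw']]
  rw [vsign_insert (Finset.notMem_erase w τ)]
  rcases lt_or_gt_of_ne hvw with h | h <;> simp [h, h.not_gt] <;> ring

/-- The projection onto the span of the generators that belong to `P`. -/
noncomputable def cut (P : Finset (Finset α)) : (Finset α →₀ ℤ) →ₗ[ℤ] (Finset α →₀ ℤ) :=
  onBasis fun τ => if τ ∈ P then e τ else 0

theorem cut_e (P : Finset (Finset α)) (τ : Finset α) : cut P (e τ) = if τ ∈ P then e τ else 0 := by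
  simp [cut]

theorem cut_smul_e (P : Finset (Finset α)) (c : ℤ) (τ : Finset α) :
    cut P (c • e τ) = if τ ∈ P then c • e τ else 0 := by
  rw [map_smul, cut_e]; split_ifs <;> simp

/-- A creation operator takes a generator to a multiple of a single generator, so truncation keeps
or drops the whole term. -/
theorem cut_ins_e (P : Finset (Finset α)) (w : α) (τ : Finset α) :
    cut P (ins w (e τ)) = if insert w τ ∈ P then ins w (e τ) else 0 := by
  obtain ⟨c, hc⟩ := exists_ins_e w τ
  rw [hc, cut_smul_e]

theorem cut_ins_del_e (P : Finset (Finset α)) (w v : α) (τ : Finset α) :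
    cut P (ins w (del v (e τ))) =
      if insert w (τ.erase v) ∈ P then ins w (del v (e τ)) else 0 := by
  obtain ⟨c, hc⟩ := exists_del_e v τ
  obtain ⟨c', hc'⟩ := exists_ins_e w (τ.erase v)
  rw [hc, map_smul, hc', smul_smul, cut_smul_e]

end Operators

/-! ### Cochain maps between a complex and its stellar subdivision -/

section Subdivision

variable {α : Type*} [LinearOrder α]

open FinComplex

theorem mem_simplices {K : FinComplex α} {reduced : Bool} {τ : Finset α} :
    τ ∈ K.simplices reduced ↔ τ ∈ K.faces ∧ (τ.Nonempty ∨ reduced = true) := by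
  cases reduced <;> simp [simplices, Finset.nonempty_iff_ne_empty, and_comm]

/-- `K'` is the stellar subdivision of `K` at `s` with apex `a`, described by its simplices. -/
structure IsStellar (K K' : FinComplex α) (s : Finset α) (a : α) : Prop where
  apex_notMem : ∀ τ ∈ K.faces, a ∉ τ
  mem_faces : s ∈ K.faces
  mem_iff : ∀ τ, τ ∈ K'.faces ↔
    ¬s ⊆ τ ∧ (a ∈ τ → s ∪ τ.erase a ∈ K.faces) ∧ (a ∉ τ → τ ∈ K.faces)

/-- The coboundary of the family `P`, where `S` contains all vertices. -/
noncomputable def cob (S : Finset α) (P : Finset (Finset α)) :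
    (Finset α →₀ ℤ) →ₗ[ℤ] (Finset α →₀ ℤ) :=
  onBasis fun τ => if τ ∈ P then ∑ w ∈ S, cut P (ins w (e τ)) else 0

/-- The transpose of the subdivision chain map from the complex `P` to its subdivision `P'`. -/
noncomputable def coarsen (S : Finset α) (P' : Finset (Finset α)) (s : Finset α) (a : α) :
    (Finset α →₀ ℤ) →ₗ[ℤ] (Finset α →₀ ℤ) :=
  onBasis fun τ => if τ ∈ P' then
    if a ∈ τ then ∑ w ∈ S, if s ⊆ insert w (τ.erase a) then ins w (del a (e τ)) else 0 else e τ
    else 0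

/-- The transpose of the chain map of the simplicial map that sends the apex `a` to `v`. -/
noncomputable def pullback (P P' : Finset (Finset α)) (a v : α) :
    (Finset α →₀ ℤ) →ₗ[ℤ] (Finset α →₀ ℤ) :=
  onBasis fun τ => if τ ∈ P then cut P' (e τ + ins a (del v (e τ))) else 0

/-- The homotopy between the identity and `pullback ∘ coarsen`. -/
noncomputable def contr (P' : Finset (Finset α)) (a v : α) :
    (Finset α →₀ ℤ) →ₗ[ℤ] (Finset α →₀ ℤ) :=
  onBasis fun τ => if τ ∈ P' ∧ a ∈ τ then -del v (e τ) else 0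

theorem pullback_smul_e {P P' : Finset (Finset α)} {a v : α} {ρ : Finset α} {c : ℤ}
    {x : Finset α →₀ ℤ} (hx : x = c • e ρ) (hρ : ρ ∈ P) :
    pullback P P' a v x = cut P' x + cut P' (ins a (del v x)) := by
  subst hx
  simp [pullback, hρ]

theorem contr_smul_e {P' : Finset (Finset α)} {a v : α} {ρ : Finset α} {c : ℤ}
    {x : Finset α →₀ ℤ} (hx : x = c • e ρ) (hρ : ρ ∈ P') (ha : a ∈ ρ) :
    contr P' a v x = -del v x := by
  subst hx
  simp [contr, hρ, ha]

theorem cob_smul_e {S : Finset α} {P : Finset (Finset α)} {ρ : Finset α} {c : ℤ}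
    {x : Finset α →₀ ℤ} (hx : x = c • e ρ) (hρ : ρ ∈ P) :
    cob S P x = ∑ w ∈ S, cut P (ins w x) := by
  subst hx
  simp [cob, hρ, Finset.smul_sum]

variable {K K' : FinComplex α} {s S : Finset α} {a v : α} {reduced : Bool}

theorem IsStellar.apex_notMem_simplex (h : IsStellar K K' s a) : a ∉ s :=
  h.apex_notMem s h.mem_faces

/-- The simplex `insert w (τ.erase a)` contains s, so it is not in K', and only the term with a in
place of v contributes. For w = v this restores τ; otherwise it exchanges the vertex v of τ for w.
-/
theorem pullback_ins_del (h : IsStellar K K' s a) (hv : v ∈ s) {τ : Finset α} {w : α}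
    (hτ : τ ∈ K'.simplices reduced) (ha : a ∈ τ) (hw : s ⊆ insert w (τ.erase a)) :
    pullback (K.simplices reduced) (K'.simplices reduced) a v (ins w (del a (e τ))) =
      if w = v then e τ else -ins w (del v (e τ)) := by
  obtain ⟨c, hc⟩ := exists_del_e a τ
  obtain ⟨c', hc'⟩ := exists_ins_e w (τ.erase a)
  have hx : ins w (del a (e τ)) = (c * c') • e (insert w (τ.erase a)) := by
    rw [hc, map_smul, hc', smul_smul]
  have has := h.apex_notMem_simplex
  obtain ⟨hτ1, hτ2⟩ := mem_simplices.1 hτ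
  obtain ⟨h1, h2, -⟩ := (h.mem_iff τ).1 hτ1
  have hws : w ∈ s := by
    by_contra hcon
    exact h1 fun x hx => by have := hw hx; grind
  have hρ : insert w (τ.erase a) ∈ K.simplices reduced :=
    mem_simplices.2 ⟨K.down_closed (h2 ha) (by grind), Or.inl (by simp)⟩
  rw [pullback_smul_e hx hρ, hx, cut_smul_e, if_neg, ← hx, zero_add]
  swap
  · intro hcon
    exact ((h.mem_iff _).1 (mem_simplices.1 hcon).1).1 hw
  have hwa : w ≠ a := by rintro rfl; exact has hws
  have hva : v ≠ a := by rintro rfl; exact has hv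
  have key : ins a (del v (ins w (del a (e τ)))) = del v (ins w (e τ)) := by
    rw [ins_del_of_ne hva.symm, ins_ins a w, map_neg, neg_neg, ins_del_self, if_pos ha]
  rw [key]
  split_ifs with hwv
  · subst hwv
    have hwτ : w ∉ τ := fun hcon => h1 fun x hx => by have := hw hx; grind
    rw [del_ins_self, if_neg hwτ, cut_e, if_pos hτ]
  · have : del v (ins w (e τ)) = -ins w (del v (e τ)) := by rw [ins_del_of_ne hwv, neg_neg]
    rw [this, map_neg, cut_ins_del_e, if_pos]
    refine mem_simplices.2 ⟨(h.mem_iff _).2 ⟨fun hcon => ?_, fun _ => ?_, fun hcon => ?_⟩,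
      Or.inl (by simp)⟩
    · have := hcon hv; grind
    · exact K.down_closed (h2 ha) (by grind)
    · grind

/-- Transposed, this says that collapsing a to v and subdividing again is homotopic to the identity,
by joining v to the simplices through a. Both sides are compared one vertex w at a time. -/
theorem pullback_coarsen (h : IsStellar K K' s a) (hS : ∀ τ ∈ K.faces, τ ⊆ S) (haS : a ∈ S)
    (hv : v ∈ s) :
    pullback (K.simplices reduced) (K'.simplices reduced) a v ∘ₗ
        coarsen S (K'.simplices reduced) s a =
      cut (K'.simplices reduced) +
        (cob S (K'.simplices reduced) ∘ₗ contr (K'.simplices reduced) a v +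
          contr (K'.simplices reduced) a v ∘ₗ cob S (K'.simplices reduced)) := by
  refine hom_ext_e fun τ => ?_
  simp only [LinearMap.comp_apply, LinearMap.add_apply]
  by_cases hτ : τ ∈ K'.simplices reduced
  swap
  · simp [coarsen, contr, cob, cut_e, hτ]
  have has := h.apex_notMem_simplex
  have hva : v ≠ a := by rintro rfl; exact has hv
  have hvS : v ∈ S := hS s h.mem_faces hv
  obtain ⟨hτ1, hτ2⟩ := mem_simplices.1 hτ
  obtain ⟨h1, h2, h3⟩ := (h.mem_iff τ).1 hτ1
  have hcob : cob S (K'.simplices reduced) (e τ) =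
      ∑ w ∈ S, if insert w τ ∈ K'.simplices reduced then ins w (e τ) else 0 := by
    simp [cob, hτ, cut_ins_e]
  rw [hcob, map_sum]
  obtain ⟨d, hd⟩ := exists_del_e v τ
  by_cases ha : a ∈ τ
  · have h2 := h2 ha
    have hL : pullback (K.simplices reduced) (K'.simplices reduced) a v
        (coarsen S (K'.simplices reduced) s a (e τ)) =
        ∑ w ∈ S, if s ⊆ insert w (τ.erase a) then
          (if w = v then e τ else -ins w (del v (e τ))) else 0 := by
      simp only [coarsen, onBasis_e, hτ, ha, if_true, map_sum]
      refine Finset.sum_congr rfl fun w _ => ?_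
      by_cases hw : s ⊆ insert w (τ.erase a)
      · rw [if_pos hw, if_pos hw, pullback_ins_del h hv hτ ha hw]
      · rw [if_neg hw, if_neg hw, map_zero]
    have hR1 : cob S (K'.simplices reduced) (contr (K'.simplices reduced) a v (e τ)) =
        ∑ w ∈ S, -(if insert w (τ.erase v) ∈ K'.simplices reduced
          then ins w (del v (e τ)) else 0) := by
      have hρ : τ.erase v ∈ K'.simplices reduced :=
        mem_simplices.2 ⟨K'.down_closed hτ1 (Finset.erase_subset _ _), Or.inl ⟨a, by grind⟩⟩
      simp only [contr, onBasis_e, hτ, ha, and_self, if_true, map_neg]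
      rw [cob_smul_e hd hρ, Finset.sum_neg_distrib]
      simp [cut_ins_del_e]
    have hR2 : ∀ w, contr (K'.simplices reduced) a v
        (if insert w τ ∈ K'.simplices reduced then ins w (e τ) else 0) =
        -(if insert w τ ∈ K'.simplices reduced then del v (ins w (e τ)) else 0) := by
      intro w
      split_ifs with hw
      · obtain ⟨c, hc⟩ := exists_ins_e w τ
        rw [contr_smul_e hc hw (by grind)]
      · simp
    rw [hL, hR1, cut_e, if_pos hτ]
    simp only [hR2]
    -- The identity term is booked as the summand w = v, which makes a comparison of summands
    -- possible.
    have he : e τ = ∑ w ∈ S, if w = v then e τ else 0 := by simp [hvS]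
    conv_rhs => lhs; rw [he]
    rw [← Finset.sum_add_distrib, ← Finset.sum_add_distrib]
    refine Finset.sum_congr rfl fun w _ => ?_
    have hmem : ∀ u, insert u τ ∈ K'.simplices reduced ↔
        ¬s ⊆ insert u τ ∧ s ∪ (insert u τ).erase a ∈ K.faces := by
      intro u
      rw [mem_simplices, h.mem_iff]
      have : (insert u τ).Nonempty := by simp
      grind
    by_cases hwv : w = v
    · subst hwv
      rw [if_pos rfl, if_pos rfl, ins_del_self, del_ins_self]
      by_cases hwτ : w ∈ τ
      · have hC1 : ¬s ⊆ insert w (τ.erase a) := fun hcon => h1 fun x hx => by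
          have := hcon hx; grind
        rw [if_neg hC1, if_pos hwτ, if_pos hwτ, Finset.insert_erase hwτ, if_pos hτ]
        simp
      · have hC : insert w τ ∈ K'.simplices reduced ↔ ¬s ⊆ insert w (τ.erase a) := by
          rw [hmem]
          have h4 : s ∪ (insert w τ).erase a ∈ K.faces := K.down_closed h2 (by grind)
          have h5 : s ⊆ insert w τ ↔ s ⊆ insert w (τ.erase a) :=
            ⟨fun h x hx => by have := h hx; grind, fun h x hx => by have := h hx; grind⟩
          simp [h4, h5]
        by_cases hC1 : s ⊆ insert w (τ.erase a) <;> simp [hC, hC1, hwτ]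
    · rw [if_neg hwv, if_neg hwv]
      have hXY : ins w (del v (e τ)) = -del v (ins w (e τ)) := ins_del_of_ne hwv _
      by_cases hvτ : v ∈ τ
      swap
      · have hX : ins w (del v (e τ)) = 0 := by rw [del_e_of_notMem hvτ, map_zero]
        have hY : del v (ins w (e τ)) = 0 := by rw [← neg_eq_zero, ← hXY, hX]
        simp [hX, hY]
      by_cases hwτ : w ∈ τ
      · have hY : del v (ins w (e τ)) = 0 := by rw [ins_e_of_mem hwτ, map_zero]
        have hX : ins w (del v (e τ)) = 0 := by rw [hXY, hY, neg_zero]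
        simp [hX, hY]
      have hC1 : s ⊆ insert w (τ.erase a) ↔ s ⊆ insert w τ :=
        ⟨fun h x hx => by have := h hx; grind, fun h x hx => by have := h hx; grind⟩
      have hC2 : insert w (τ.erase v) ∈ K'.simplices reduced ↔
          s ∪ (insert w τ).erase a ∈ K.faces := by
        have h4 : s ∪ (insert w (τ.erase v)).erase a = s ∪ (insert w τ).erase a := by grind
        have h5 : ¬s ⊆ insert w (τ.erase v) := fun hcon => by have := hcon hv; grind
        have h6 : a ∈ insert w (τ.erase v) := by grind
        have : (insert w (τ.erase v)).Nonempty := by simp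
        rw [mem_simplices, h.mem_iff, h4]
        grind
      have hC3 : s ⊆ insert w τ → s ∪ (insert w τ).erase a ∈ K.faces := fun hcon => by
        have hws : w ∈ s := by
          by_contra hws
          exact h1 fun x hx => by have := hcon hx; grind
        exact K.down_closed h2 (by grind)
      rw [hXY]
      simp only [hC1, hC2, hmem]
      by_cases hs : s ⊆ insert w τ
      · simp [hs, hC3 hs]
      · by_cases hs' : s ∪ (insert w τ).erase a ∈ K.faces <;> simp [hs, hs']
  · have h3 := h3 ha
    have hτP : τ ∈ K.simplices reduced := mem_simplices.2 ⟨h3, hτ2⟩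
    have hL : coarsen S (K'.simplices reduced) s a (e τ) = e τ := by simp [coarsen, hτ, ha]
    have hR1 : contr (K'.simplices reduced) a v (e τ) = 0 := by simp [contr, ha]
    -- As `contr` vanishes on simplices without a, only the summand w = a of the coboundary of τ
    -- matters.
    rw [hL, hR1, map_zero, zero_add, cut_e, if_pos hτ,
      pullback_smul_e (one_smul ℤ (e τ)).symm hτP, cut_e, if_pos hτ, add_right_inj,
      Finset.sum_eq_single_of_mem a haS]
    swap
    · intro w _ hwa
      split_ifs with hw
      · obtain ⟨c, hc⟩ := exists_ins_e w τ
        rw [hc, map_smul]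
        have : a ∉ insert w τ := by grind
        simp [contr, this]
      · simp
    rw [cut_ins_del_e]
    by_cases hvτ : v ∈ τ
    swap
    · rw [del_e_of_notMem hvτ, map_zero, ite_self]
      split_ifs with hw
      · obtain ⟨c, hc⟩ := exists_ins_e a τ
        rw [contr_smul_e hc hw (by simp), ← map_neg, hc, map_neg, map_smul,
          del_e_of_notMem (by grind)]
        simp
      · simp
    have hC : insert a (τ.erase v) ∈ K'.simplices reduced ↔ insert a τ ∈ K'.simplices reduced := by
      rw [mem_simplices, mem_simplices, h.mem_iff, h.mem_iff]
      have h4 : s ∪ (insert a (τ.erase v)).erase a = s ∪ (insert a τ).erase a := by grind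
      have h5 : ¬s ⊆ insert a (τ.erase v) := fun hcon => by have := hcon hv; grind
      have h6 : ¬s ⊆ insert a τ := fun hcon => h1 fun x hx => by have := hcon hx; grind
      rw [h4]
      simp [h5, h6]
    simp only [hC]
    split_ifs with hw
    · obtain ⟨c, hc⟩ := exists_ins_e a τ
      rw [contr_smul_e hc hw (by simp), ins_del_of_ne hva.symm]
    · simp

end Subdivision

/-! ### Relations between coarsening, pullback and coboundary -/

section Subdivision

variable {α : Type*} [LinearOrder α]

open FinComplex

variable {K K' : FinComplex α} {s S : Finset α} {a v : α} {reduced : Bool}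

theorem simplices_of_subset {τ ρ : Finset α} (h : ρ ∈ K.simplices reduced) (hs : τ ⊆ ρ)
    (hτ : τ.Nonempty ∨ reduced = true) : τ ∈ K.simplices reduced :=
  mem_simplices.2 ⟨K.down_closed (mem_simplices.1 h).1 hs, hτ⟩

theorem union_erase_apex {τ : Finset α} (hv : v ∈ s) (ha : a ∉ τ) :
    s ∪ (insert a (τ.erase v)).erase a = s ∪ τ := by
  grind

theorem not_subset_insert_erase {τ : Finset α} (hv : v ∈ s) (hva : v ≠ a) :
    ¬s ⊆ insert a (τ.erase v) := fun h => by
  have := h hv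
  grind

theorem coarsen_smul_e {P' : Finset (Finset α)} {ρ : Finset α} {c : ℤ}
    {x : Finset α →₀ ℤ} (hx : x = c • e ρ) (hρ : ρ ∈ P') (ha : a ∈ ρ) :
    coarsen S P' s a x =
      ∑ w ∈ S, if s ⊆ insert w (ρ.erase a) then ins w (del a x) else 0 := by
  subst hx
  simp [coarsen, hρ, ha, Finset.smul_sum]

/-- After v has been deleted, `coarsen` is nonzero only if v is the one vertex of s that is missing,
which would put s inside τ. This yields the side condition g ∘ H = 0 of the perturbation lemma. -/
theorem coarsen_contr (h : IsStellar K K' s a) (hv : v ∈ s) :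
    coarsen S (K'.simplices reduced) s a ∘ₗ contr (K'.simplices reduced) a v = 0 := by
  refine hom_ext_e fun τ => ?_
  simp only [LinearMap.comp_apply, LinearMap.zero_apply]
  by_cases hτ : τ ∈ K'.simplices reduced ∧ a ∈ τ
  swap
  · simp [contr, hτ]
  obtain ⟨hτ, ha⟩ := hτ
  have hva : v ≠ a := by rintro rfl; exact h.apex_notMem_simplex hv
  have has := h.apex_notMem_simplex
  have h1 := ((h.mem_iff τ).1 (mem_simplices.1 hτ).1).1
  by_cases hvτ : v ∈ τ
  swap
  · simp [contr, hτ, ha, del_e_of_notMem hvτ]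
  obtain ⟨d, hd⟩ := exists_del_e v τ
  have hρ : τ.erase v ∈ K'.simplices reduced :=
    simplices_of_subset hτ (Finset.erase_subset _ _) (Or.inl ⟨a, by grind⟩)
  simp only [contr, onBasis_e, hτ, ha, and_self, if_true, map_neg, neg_eq_zero]
  rw [coarsen_smul_e hd hρ (by grind)]
  refine Finset.sum_eq_zero fun w _ => if_neg fun hw => h1 fun x hx => ?_
  have h3 := hw hv
  have h4 := hw hx
  grind

/-- If τ does not contain s, the term τ survives and the apex term is coarsened to zero. If τ
contains s, it is not in K', and the apex term returns τ through w = v alone. -/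
theorem coarsen_pullback (h : IsStellar K K' s a) (hS : ∀ τ ∈ K.faces, τ ⊆ S) (hv : v ∈ s) :
    coarsen S (K'.simplices reduced) s a ∘ₗ
      pullback (K.simplices reduced) (K'.simplices reduced) a v = cut (K.simplices reduced) := by
  refine hom_ext_e fun τ => ?_
  simp only [LinearMap.comp_apply]
  by_cases hτ : τ ∈ K.simplices reduced
  swap
  · simp [pullback, cut_e, hτ]
  obtain ⟨hτ1, hτ2⟩ := mem_simplices.1 hτ
  have hva : v ≠ a := by rintro rfl; exact h.apex_notMem_simplex hv
  have has := h.apex_notMem_simplex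
  have haτ := h.apex_notMem τ hτ1
  rw [pullback_smul_e (one_smul ℤ (e τ)).symm hτ, cut_e, cut_ins_del_e, cut_e, if_pos hτ, map_add]
  obtain ⟨d, hd⟩ := exists_del_e v τ
  obtain ⟨d', hd'⟩ := exists_ins_e a (τ.erase v)
  have hx : ins a (del v (e τ)) = (d * d') • e (insert a (τ.erase v)) := by
    rw [hd, map_smul, hd', smul_smul]
  have hda : del a (ins a (del v (e τ))) = del v (e τ) := by
    rw [hd, map_smul, map_smul, del_ins_self, if_neg (by grind)]
  have hmem : τ ∈ K'.simplices reduced ↔ ¬s ⊆ τ := by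
    rw [mem_simplices, h.mem_iff]; simp [haτ, hτ1, hτ2]
  by_cases hvτ : v ∈ τ
  swap
  · rw [if_pos (hmem.2 fun hcon => hvτ (hcon hv)), del_e_of_notMem hvτ]
    have : τ ∈ K'.simplices reduced := hmem.2 fun hcon => hvτ (hcon hv)
    simp [coarsen, this, haτ]
  have hmem' : insert a (τ.erase v) ∈ K'.simplices reduced ↔ s ∪ τ ∈ K.faces := by
    rw [mem_simplices, h.mem_iff]
    have h4 := union_erase_apex hv haτ
    have h5 := not_subset_insert_erase (τ := τ) hv hva
    rw [h4]; simp [h5]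
  have hw : ∀ w, s ⊆ insert w ((insert a (τ.erase v)).erase a) ↔ w = v ∧ s ⊆ τ := by
    intro w
    have h4 : (insert a (τ.erase v)).erase a = τ.erase v := by grind
    rw [h4]
    constructor
    · intro hw
      have hwv : w = v := by have := hw hv; grind
      exact ⟨hwv, fun x hx => by have := hw hx; grind⟩
    · rintro ⟨rfl, hs⟩
      rwa [Finset.insert_erase hvτ]
  have hsecond : coarsen S (K'.simplices reduced) s a
      (if insert a (τ.erase v) ∈ K'.simplices reduced then ins a (del v (e τ)) else 0) =
      if s ⊆ τ then e τ else 0 := by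
    split_ifs with h1 h2 h2
    · rw [coarsen_smul_e hx h1 (by simp), hda, Finset.sum_eq_single_of_mem v (hS s h.mem_faces hv)]
      · rw [if_pos ((hw v).2 ⟨rfl, h2⟩), ins_del_self, if_pos hvτ]
      · intro w _ hwv
        rw [if_neg fun hcon => hwv ((hw w).1 hcon).1]
    · rw [coarsen_smul_e hx h1 (by simp)]
      exact Finset.sum_eq_zero fun w _ => if_neg fun hcon => h2 ((hw w).1 hcon).2
    · exact absurd (hmem'.2 (by rwa [Finset.union_eq_right.2 h2])) h1
    · simp
  rw [hsecond]
  by_cases h2 : s ⊆ τ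
  · simp [hmem, h2]
  · have : τ ∈ K'.simplices reduced := hmem.2 h2
    simp [h2, coarsen, this, haτ]

/-- The reason is that a ↦ v defines a simplicial map from K' to K. -/
theorem pullback_cob (h : IsStellar K K' s a) (hS : ∀ τ ∈ K.faces, τ ⊆ S) (haS : a ∈ S)
    (hv : v ∈ s) :
    pullback (K.simplices reduced) (K'.simplices reduced) a v ∘ₗ cob S (K.simplices reduced) =
      cob S (K'.simplices reduced) ∘ₗ
        pullback (K.simplices reduced) (K'.simplices reduced) a v := by
  refine hom_ext_e fun τ => ?_
  simp only [LinearMap.comp_apply]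
  by_cases hτ : τ ∈ K.simplices reduced
  swap
  · simp [pullback, cob, hτ]
  obtain ⟨hτ1, hτ2⟩ := mem_simplices.1 hτ
  have hva : v ≠ a := by rintro rfl; exact h.apex_notMem_simplex hv
  have has := h.apex_notMem_simplex
  have haτ := h.apex_notMem τ hτ1
  have hvS : v ∈ S := hS s h.mem_faces hv
  have hmem : τ ∈ K'.simplices reduced ↔ ¬s ⊆ τ := by
    rw [mem_simplices, h.mem_iff]; simp [haτ, hτ1, hτ2]
  have hmema : insert a τ ∈ K'.simplices reduced ↔ ¬s ⊆ τ ∧ s ∪ τ ∈ K.faces := by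
    rw [mem_simplices, h.mem_iff]
    have h4 : s ∪ (insert a τ).erase a = s ∪ τ := by rw [Finset.erase_insert haτ]
    have h5 : s ⊆ insert a τ ↔ s ⊆ τ :=
      Finset.subset_insert_iff_of_notMem has
    rw [h4, h5]; simp
  obtain ⟨d, hd⟩ := exists_del_e v τ
  obtain ⟨d', hd'⟩ := exists_ins_e a (τ.erase v)
  have hx : ins a (del v (e τ)) = (d * d') • e (insert a (τ.erase v)) := by
    rw [hd, map_smul, hd', smul_smul]
  have hL : ∀ w, pullback (K.simplices reduced) (K'.simplices reduced) a v
      (cut (K.simplices reduced) (ins w (e τ))) =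
      if insert w τ ∈ K.simplices reduced then
        (if insert w τ ∈ K'.simplices reduced then ins w (e τ) else 0) +
        (if insert a ((insert w τ).erase v) ∈ K'.simplices reduced then
          ins a (del v (ins w (e τ))) else 0) else 0 := by
    intro w
    rw [cut_ins_e]
    split_ifs with h1
    all_goals first
      | rw [map_zero]
      | obtain ⟨c, hc⟩ := exists_ins_e w τ
        rw [pullback_smul_e hc h1, cut_ins_e, hc, map_smul, map_smul, map_smul, cut_ins_del_e]
        split_ifs
        all_goals simp_all
  have hR1 : cob S (K'.simplices reduced) (if τ ∈ K'.simplices reduced then e τ else 0) =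
      ∑ w ∈ S, if τ ∈ K'.simplices reduced ∧ insert w τ ∈ K'.simplices reduced then
        ins w (e τ) else 0 := by
    by_cases h1 : τ ∈ K'.simplices reduced <;> simp [cob, h1, cut_ins_e]
  have hR2 : cob S (K'.simplices reduced) (if insert a (τ.erase v) ∈ K'.simplices reduced then
        ins a (del v (e τ)) else 0) =
      ∑ w ∈ S, if insert a (τ.erase v) ∈ K'.simplices reduced ∧
          insert w (insert a (τ.erase v)) ∈ K'.simplices reduced then
        ins w (ins a (del v (e τ))) else 0 := by
    by_cases h1 : insert a (τ.erase v) ∈ K'.simplices reduced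
    · rw [if_pos h1, cob_smul_e hx h1]
      refine Finset.sum_congr rfl fun w _ => ?_
      rw [hx, map_smul, map_smul, cut_ins_e]
      simp [h1]
    · simp [h1]
  have hcob : cob S (K.simplices reduced) (e τ) =
      ∑ w ∈ S, cut (K.simplices reduced) (ins w (e τ)) := by
    simp [cob, hτ]
  rw [hcob, map_sum, pullback_smul_e (one_smul ℤ (e τ)).symm hτ, cut_e, cut_ins_del_e, map_add,
    hR1, hR2, ← Finset.sum_add_distrib]
  simp only [hL]
  -- The summands for w = a and for w = v do not match individually. Adding Q at w = a on the left
  -- and at w = v on the right balances both.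
  set Q : Finset α →₀ ℤ := if insert a τ ∈ K'.simplices reduced then ins a (e τ) else 0 with hQ
  have hQa : (∑ w ∈ S, if w = a then Q else 0) = Q := by simp [haS]
  have hQv : (∑ w ∈ S, if w = v then Q else 0) = Q := by simp [hvS]
  rw [← add_left_inj Q]
  conv_lhs => rhs; rw [← hQa]
  conv_rhs => rhs; rw [← hQv]
  rw [← Finset.sum_add_distrib, ← Finset.sum_add_distrib]
  refine Finset.sum_congr rfl fun w _ => ?_
  by_cases hwa : w = a
  · subst hwa
    have h1 : insert w τ ∉ K.simplices reduced := fun hcon =>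
      h.apex_notMem _ (mem_simplices.1 hcon).1 (Finset.mem_insert_self w τ)
    have h2 : ins w (ins w (del v (e τ))) = 0 := by
      rw [hx, map_smul, ins_e_of_mem (by simp), smul_zero]
    rw [if_neg h1, if_pos rfl, h2, ite_self, zero_add, add_zero,
      if_neg (fun hcon : w = v => hva hcon.symm), add_zero, hQ]
    simp only [hmem, hmema]
    by_cases h3 : s ⊆ τ <;> simp [h3]
  by_cases hwv : w = v
  · subst hwv
    rw [if_pos rfl, if_neg hwa, add_zero]
    by_cases hvτ : w ∈ τ
    · have h1 : ins w (ins a (del w (e τ))) = -ins a (e τ) := by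
        rw [ins_ins, ins_del_self, if_pos hvτ]
      have h2 : insert a (τ.erase w) ∈ K'.simplices reduced ↔ s ∪ τ ∈ K.faces := by
        rw [mem_simplices, h.mem_iff]
        have h4 := union_erase_apex hv haτ
        have h5 := not_subset_insert_erase (τ := τ) hv hva
        rw [h4]; simp [h5]
      have h3 : insert w (insert a (τ.erase w)) = insert a τ := by
        rw [Finset.insert_comm, Finset.insert_erase hvτ]
      rw [ins_e_of_mem hvτ, h1, h3, hQ]
      simp only [h2, hmema]
      by_cases h5 : s ⊆ τ <;> by_cases h6 : s ∪ τ ∈ K.faces <;> simp [h5, h6]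
    · have h1 : s ∪ τ ∈ K.faces → insert w τ ∈ K.simplices reduced := fun hcon =>
        mem_simplices.2 ⟨K.down_closed hcon (Finset.insert_subset
          (Finset.mem_union_left _ hv) Finset.subset_union_right), Or.inl (by simp)⟩
      have h2 : insert w τ ∈ K'.simplices reduced → insert w τ ∈ K.simplices reduced := fun hcon =>
        mem_simplices.2 ⟨((h.mem_iff _).1 (mem_simplices.1 hcon).1).2.2
          (by simp [Ne.symm hwa, haτ]),
          Or.inl (by simp)⟩
      have h3 : ¬s ⊆ τ := fun hcon => hvτ (hcon hv)
      rw [del_ins_self, if_neg hvτ, del_e_of_notMem hvτ, map_zero, map_zero, ite_self, add_zero,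
        Finset.erase_insert hvτ, hQ]
      simp only [hmem, hmema, h3, not_false_eq_true, true_and]
      by_cases h4 : insert w τ ∈ K.simplices reduced
      · rw [if_pos h4]
      · rw [if_neg h4, if_neg fun hcon => h4 (h1 hcon), if_neg fun hcon => h4 (h2 hcon), add_zero]
  · rw [if_neg hwa, if_neg hwv, add_zero, add_zero]
    have h1 : insert w τ ∈ K'.simplices reduced →
        insert w τ ∈ K.simplices reduced ∧ τ ∈ K'.simplices reduced := fun hcon =>
      ⟨mem_simplices.2 ⟨((h.mem_iff _).1 (mem_simplices.1 hcon).1).2.2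
          (by simp [Ne.symm hwa, haτ]),
        Or.inl (by simp)⟩, simplices_of_subset hcon (Finset.subset_insert _ _) hτ2⟩
    have h2 : ins a (del v (ins w (e τ))) = ins w (ins a (del v (e τ))) := by
      rw [ins_ins w a, ins_del_of_ne hwv, map_neg, neg_neg]
    have hfst : (if insert w τ ∈ K.simplices reduced then
        if insert w τ ∈ K'.simplices reduced then ins w (e τ) else 0 else 0) =
        if τ ∈ K'.simplices reduced ∧ insert w τ ∈ K'.simplices reduced then
          ins w (e τ) else 0 := by
      by_cases h3 : insert w τ ∈ K'.simplices reduced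
      · simp [h3, h1 h3]
      · simp [h3]
    have hsnd : (if insert w τ ∈ K.simplices reduced then
        if insert a ((insert w τ).erase v) ∈ K'.simplices reduced then
          ins a (del v (ins w (e τ))) else 0 else 0) =
        if insert a (τ.erase v) ∈ K'.simplices reduced ∧
            insert w (insert a (τ.erase v)) ∈ K'.simplices reduced then
          ins w (ins a (del v (e τ))) else 0 := by
      by_cases hvτ : v ∈ τ
      swap
      · have : ins w (ins a (del v (e τ))) = 0 := by
          rw [del_e_of_notMem hvτ, map_zero, map_zero]
        simp [h2, this]
      have h3 : insert w (insert a (τ.erase v)) = insert a ((insert w τ).erase v) := by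
        rw [Finset.insert_comm, Finset.erase_insert_of_ne hwv]
      rw [h2, h3]
      by_cases h4 : insert a ((insert w τ).erase v) ∈ K'.simplices reduced
      · have h5 : insert w τ ∈ K.simplices reduced := by
          refine mem_simplices.2 ⟨?_, Or.inl (by simp)⟩
          refine K.down_closed (((h.mem_iff _).1 (mem_simplices.1 h4).1).2.1 (by simp)) ?_
          rw [union_erase_apex hv (by simp [Ne.symm hwa, haτ])]
          exact Finset.subset_union_right
        have h6 : insert a (τ.erase v) ∈ K'.simplices reduced :=
          simplices_of_subset h4 (Finset.insert_subset_insert _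
            (Finset.erase_subset_erase _ (Finset.subset_insert _ _))) (Or.inl (by simp))
        simp [h4, h5, h6]
      · simp [h4]
    rw [← hfst, ← hsnd]
    split_ifs <;> simp

theorem cob_cob : cob S (K.simplices reduced) ∘ₗ cob S (K.simplices reduced) = 0 := by
  refine hom_ext_e fun τ => ?_
  simp only [LinearMap.comp_apply, LinearMap.zero_apply]
  by_cases hτ : τ ∈ K.simplices reduced
  swap
  · simp [cob, hτ]
  -- The inner truncation can be dropped: if `insert w τ` is not a simplex, no larger set is.
  have h1 : ∀ w, cob S (K.simplices reduced) (cut (K.simplices reduced) (ins w (e τ))) =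
      cut (K.simplices reduced) (∑ u ∈ S, ins u (ins w (e τ))) := by
    intro w
    obtain ⟨c, hc⟩ := exists_ins_e w τ
    rw [cut_ins_e, map_sum]
    split_ifs with hw
    · exact cob_smul_e hc hw
    · rw [map_zero]
      refine (Finset.sum_eq_zero fun u _ => ?_).symm
      rw [hc, map_smul, map_smul, cut_ins_e, if_neg, smul_zero]
      exact fun hcon => hw (simplices_of_subset hcon (Finset.subset_insert _ _) (Or.inl (by simp)))
  -- Exchanging the summations changes the sign, and the group has no 2-torsion.
  have h2 : (∑ w ∈ S, ∑ u ∈ S, ins u (ins w (e τ))) = 0 := by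
    have h3 : (∑ w ∈ S, ∑ u ∈ S, ins u (ins w (e τ))) =
        -∑ w ∈ S, ∑ u ∈ S, ins u (ins w (e τ)) := by
      conv_lhs => rw [Finset.sum_comm]
      rw [← Finset.sum_neg_distrib]
      refine Finset.sum_congr rfl fun w _ => ?_
      rw [← Finset.sum_neg_distrib]
      exact Finset.sum_congr rfl fun u _ => ins_ins _ _ _
    ext ρ
    have := DFunLike.congr_fun h3 ρ
    rw [Finsupp.neg_apply] at this
    simp only [Finsupp.zero_apply]
    omega
  have h3 : cob S (K.simplices reduced) (e τ) =
      ∑ w ∈ S, cut (K.simplices reduced) (ins w (e τ)) := by simp [cob, hτ]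
  rw [h3, map_sum]
  simp only [h1]
  rw [← map_sum, h2, map_zero]

end Subdivision

/-! ### Carriers and supports of the cochain maps -/

section Supports

variable {α : Type*} [LinearOrder α]

open FinComplex

variable {K K' : FinComplex α} {s S : Finset α} {a v : α} {reduced : Bool}

/-- The group of the chains that are supported on `X`. -/
abbrev chainsOn (X : Set (Finset α)) : Submodule ℤ (Finset α →₀ ℤ) := Finsupp.supported ℤ ℤ X

theorem e_mem_chainsOn {X : Set (Finset α)} {τ : Finset α} (h : τ ∈ X) : e τ ∈ chainsOn X :=
  Finsupp.single_mem_supported ℤ _ h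

theorem chainsOn_le {X : Set (Finset α)} {Q : Submodule ℤ (Finset α →₀ ℤ)}
    (h : ∀ τ ∈ X, e τ ∈ Q) : chainsOn X ≤ Q := by
  unfold chainsOn
  rw [Finsupp.supported_eq_span_single, Submodule.span_le]
  rintro _ ⟨τ, hτ, rfl⟩
  exact h τ hτ

theorem map_mem_of_mem_chainsOn {M : Type*} [AddCommGroup M] {X : Set (Finset α)}
    {Q : Submodule ℤ M} {φ : (Finset α →₀ ℤ) →ₗ[ℤ] M} (h : ∀ τ ∈ X, φ (e τ) ∈ Q)
    {x : Finset α →₀ ℤ} (hx : x ∈ chainsOn X) : φ x ∈ Q :=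
  chainsOn_le (Q := Q.comap φ) h hx

theorem ins_mem_chainsOn {X : Set (Finset α)} {w : α} {τ : Finset α}
    (h : w ∉ τ → insert w τ ∈ X) : ins w (e τ) ∈ chainsOn X := by
  by_cases hw : w ∈ τ
  · rw [ins_e_of_mem hw]; exact Submodule.zero_mem _
  · rw [ins_e_of_notMem hw]; exact Submodule.smul_mem _ _ (e_mem_chainsOn (h hw))

theorem del_mem_chainsOn {X : Set (Finset α)} {w : α} {τ : Finset α}
    (h : w ∈ τ → τ.erase w ∈ X) : del w (e τ) ∈ chainsOn X := by
  by_cases hw : w ∈ τ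
  · rw [del_e_of_mem hw]; exact Submodule.smul_mem _ _ (e_mem_chainsOn (h hw))
  · rw [del_e_of_notMem hw]; exact Submodule.zero_mem _

theorem ins_del_mem_chainsOn {X : Set (Finset α)} {w v : α} {τ : Finset α}
    (h : v ∈ τ → w ∉ τ.erase v → insert w (τ.erase v) ∈ X) :
    ins w (del v (e τ)) ∈ chainsOn X := by
  by_cases hv : v ∈ τ
  · rw [del_e_of_mem hv, map_smul]
    exact Submodule.smul_mem _ _ (ins_mem_chainsOn (h hv))
  · rw [del_e_of_notMem hv, map_zero]; exact Submodule.zero_mem _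

/-- The smallest simplex of `K` that contains the simplex `ρ` of the subdivision. -/
def carrier (s : Finset α) (a : α) (ρ : Finset α) : Finset α :=
  if a ∈ ρ then s ∪ ρ.erase a else ρ

theorem carrier_mono {ρ ρ' : Finset α} (h : ρ ⊆ ρ') : carrier s a ρ ⊆ carrier s a ρ' := by
  unfold carrier
  split_ifs with h1 h2 h2
  · exact Finset.union_subset_union_right (Finset.erase_subset_erase _ h)
  · exact absurd (h h1) h2
  · intro x hx
    exact Finset.mem_union_right _ (Finset.mem_erase.2 ⟨fun hxa => h1 (hxa ▸ hx), h hx⟩)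
  · exact h

theorem subset_insert_carrier (ρ : Finset α) : ρ ⊆ insert a (carrier s a ρ) := by
  intro x hx
  unfold carrier
  split_ifs <;> grind

theorem cob_mem (P : Finset (Finset α)) (τ : Finset α) :
    cob S P (e τ) ∈ chainsOn {τ' | τ ∈ P ∧ τ' ∈ P ∧ τ ⊆ τ' ∧ τ'.card = τ.card + 1} := by
  unfold cob
  rw [onBasis_e]
  split_ifs with hτ
  · refine sum_mem fun w _ => ?_
    rw [cut_ins_e]
    split_ifs with hw
    · exact ins_mem_chainsOn fun h =>
        ⟨hτ, hw, Finset.subset_insert _ _, Finset.card_insert_of_notMem h⟩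
    · exact Submodule.zero_mem _
  · exact Submodule.zero_mem _

/-- For a ∈ τ the vertex w that replaces a must lie in s, as otherwise s ⊆ τ. Hence each term is
exactly the carrier of τ. -/
theorem coarsen_mem (h : IsStellar K K' s a) (τ : Finset α) :
    coarsen S (K'.simplices reduced) s a (e τ) ∈
      chainsOn {σ | τ ∈ K'.simplices reduced ∧ σ ∈ K.simplices reduced ∧ carrier s a τ ⊆ σ ∧
        σ.card = τ.card} := by
  unfold coarsen
  rw [onBasis_e]
  split_ifs with hτ ha
  · refine sum_mem fun w _ => ?_
    obtain ⟨h1, h2, -⟩ := (h.mem_iff τ).1 (mem_simplices.1 hτ).1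
    split_ifs with hw
    · refine ins_del_mem_chainsOn fun _ hwτ => ⟨hτ, ?_, ?_, ?_⟩
      · refine mem_simplices.2 ⟨K.down_closed (h2 ha) ?_, Or.inl (by simp)⟩
        have hws : w ∈ s := by
          by_contra hws
          refine h1 fun x hx => ?_
          have := hw hx
          grind
        grind
      · rw [carrier, if_pos ha]
        exact Finset.union_subset hw (Finset.subset_insert _ _)
      · rw [Finset.card_insert_of_notMem hwτ, Finset.card_erase_add_one ha]
    · exact Submodule.zero_mem _
  · obtain ⟨h1, h2⟩ := mem_simplices.1 hτ
    refine e_mem_chainsOn ⟨hτ, mem_simplices.2 ⟨((h.mem_iff τ).1 h1).2.2 ha, h2⟩, ?_, rfl⟩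
    rw [carrier, if_neg ha]
  · exact Submodule.zero_mem _

/-- The last condition keeps flags flags. For the term τ itself, s is not contained in τ, so ρ₀
cannot contain a and equals its carrier. For the apex term, only v has been removed from τ, and ρ₀
avoids v. -/
theorem pullback_mem (h : IsStellar K K' s a) (hv : v ∈ s) (τ : Finset α) :
    pullback (K.simplices reduced) (K'.simplices reduced) a v (e τ) ∈
      chainsOn {ρ | τ ∈ K.simplices reduced ∧ ρ ∈ K'.simplices reduced ∧ τ ⊆ carrier s a ρ ∧
        ρ.card = τ.card ∧ ∀ ρ₀, carrier s a ρ₀ ⊆ τ → v ∉ ρ₀ → ρ₀ ⊆ ρ} := by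
  unfold pullback
  rw [onBasis_e]
  split_ifs with hτ
  swap
  · exact Submodule.zero_mem _
  have haτ := h.apex_notMem τ (mem_simplices.1 hτ).1
  rw [map_add, cut_e, cut_ins_del_e]
  refine add_mem ?_ ?_
  · split_ifs with h1
    · refine e_mem_chainsOn ⟨hτ, h1, by rw [carrier, if_neg haτ], rfl, fun ρ₀ hρ _ => ?_⟩
      unfold carrier at hρ
      split_ifs at hρ with h2
      · exact absurd (Finset.subset_union_left.trans hρ)
          ((h.mem_iff τ).1 (mem_simplices.1 h1).1).1
      · exact hρ
    · exact Submodule.zero_mem _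
  · split_ifs with h1
    · refine ins_del_mem_chainsOn fun hvτ hw => ⟨hτ, h1, ?_, ?_, fun ρ₀ hρ hvρ => ?_⟩
      · rw [carrier, if_pos (by simp), union_erase_apex hv haτ]
        exact Finset.subset_union_right
      · rw [Finset.card_insert_of_notMem hw, Finset.card_erase_add_one hvτ]
      · intro x hx
        have h3 := subset_insert_carrier (s := s) (a := a) ρ₀ hx
        rw [Finset.mem_insert] at h3 ⊢
        refine h3.imp_right fun h4 => Finset.mem_erase.2 ⟨?_, hρ h4⟩
        rintro rfl
        exact hvρ hx
    · exact Submodule.zero_mem _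

/-- The carrier is unchanged because v lies in s and a stays. This is needed when the homotopy acts
on the first factor; the last condition is needed when it acts on the second, where no vertex of the
first factor may be lost. -/
theorem contr_mem (h : IsStellar K K' s a) (hv : v ∈ s) (τ : Finset α) :
    contr (K'.simplices reduced) a v (e τ) ∈
      chainsOn {ρ | τ ∈ K'.simplices reduced ∧ ρ ∈ K'.simplices reduced ∧
        carrier s a τ = carrier s a ρ ∧ ρ.card + 1 = τ.card ∧ τ ⊆ insert v ρ} := by
  unfold contr
  rw [onBasis_e]
  split_ifs with hτ
  swap
  · exact Submodule.zero_mem _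
  have hva : v ≠ a := by rintro rfl; exact h.apex_notMem_simplex hv
  obtain ⟨hτ, ha⟩ := hτ
  have haτ : a ∈ τ.erase v := Finset.mem_erase.2 ⟨hva.symm, ha⟩
  refine neg_mem (del_mem_chainsOn fun hvτ => ⟨hτ,
    simplices_of_subset hτ (Finset.erase_subset _ _) (Or.inl ⟨a, haτ⟩), ?_,
    Finset.card_erase_add_one hvτ, ?_⟩)
  · rw [carrier, carrier, if_pos ha, if_pos haτ]
    grind
  · rw [Finset.insert_erase hvτ]

theorem cut_of_mem_chainsOn {P : Finset (Finset α)} {X : Set (Finset α)} (hX : ∀ τ ∈ X, τ ∈ P)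
    {x : Finset α →₀ ℤ} (hx : x ∈ chainsOn X) : cut P x = x := by
  have : chainsOn X ≤ LinearMap.ker (cut P - LinearMap.id) :=
    chainsOn_le fun τ hτ => by simp [cut_e, hX τ hτ]
  simpa [sub_eq_zero] using this hx

/-- No direct computation is needed. By the homotopy formula the composite of `coarsen` and
`pullback` commutes with the coboundary, and so does `pullback`. Applying `coarsen`, which is a left
inverse of `pullback`, cancels the latter. The vertex v is auxiliary. -/
theorem coarsen_cob (h : IsStellar K K' s a) (hS : ∀ τ ∈ K.faces, τ ⊆ S) (haS : a ∈ S)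
    (hne : s.Nonempty) :
    coarsen S (K'.simplices reduced) s a ∘ₗ cob S (K'.simplices reduced) =
      cob S (K.simplices reduced) ∘ₗ coarsen S (K'.simplices reduced) s a := by
  obtain ⟨v, hv⟩ := hne
  have h1 := LinearMap.congr_fun (pullback_coarsen (reduced := reduced) h hS haS hv)
  have h2 := LinearMap.congr_fun (pullback_cob (reduced := reduced) h hS haS hv)
  have h3 := LinearMap.congr_fun (coarsen_pullback (reduced := reduced) h hS hv)
  have h4 := LinearMap.congr_fun (cob_cob (K := K') (S := S) (reduced := reduced))
  simp only [LinearMap.comp_apply, LinearMap.add_apply, LinearMap.zero_apply] at h1 h2 h3 h4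
  refine hom_ext_e fun τ => ?_
  simp only [LinearMap.comp_apply]
  by_cases hτ : τ ∈ K'.simplices reduced
  swap
  · simp [cob, coarsen, hτ]
  have h5 := h1 (cob S (K'.simplices reduced) (e τ))
  have h6 := congrArg (cob S (K'.simplices reduced)) (h1 (e τ))
  rw [cut_of_mem_chainsOn (fun _ hx => hx.2.1) (cob_mem _ τ), h4, map_zero, add_zero] at h5
  rw [cut_e, if_pos hτ, map_add, map_add, h4, zero_add, ← h5, ← h2] at h6
  have h7 := congrArg (coarsen S (K'.simplices reduced) s a) h6
  rw [h3, h3] at h7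
  have h8 : coarsen S (K'.simplices reduced) s a (cob S (K'.simplices reduced) (e τ)) ∈
      chainsOn {σ | σ ∈ K.simplices reduced} :=
    map_mem_of_mem_chainsOn
      (fun ρ _ => Finsupp.supported_mono (fun _ hx => hx.2.1) (coarsen_mem h ρ)) (cob_mem _ τ)
  have h9 : cob S (K.simplices reduced) (coarsen S (K'.simplices reduced) s a (e τ)) ∈
      chainsOn {σ | σ ∈ K.simplices reduced} :=
    map_mem_of_mem_chainsOn
      (fun ρ _ => Finsupp.supported_mono (fun _ hx => hx.2.1) (cob_mem _ ρ)) (coarsen_mem h τ)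
  rw [cut_of_mem_chainsOn (fun _ hx => hx) h8, cut_of_mem_chainsOn (fun _ hx => hx) h9] at h7
  exact h7.symm

end Supports

/-! ### The bicomplex as a group of endomorphisms of cochains -/

section Pairs

variable {α : Type*} [LinearOrder α]

open FinComplex

/-- The endomorphisms of the free group on all finite sets. The endomorphism that sends `e σ` to
`e τ` and the other generators to zero stands for `σ ⊗ τ`. -/
abbrev PairSpace (α : Type*) : Type _ := (Finset α →₀ ℤ) →ₗ[ℤ] (Finset α →₀ ℤ)

/-- The endomorphism `σ ⊗ τ`. -/
noncomputable def pair (z : Finset α × Finset α) : PairSpace α :=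
  onBasis fun ρ => if ρ = z.1 then e z.2 else 0

/-- The endomorphisms that are supported on a set of pairs. -/
def pairsOn (X : Set (Finset α × Finset α)) : Submodule ℤ (PairSpace α) where
  carrier := {T | ∀ σ, T (e σ) ∈ chainsOn {τ | (σ, τ) ∈ X}}
  zero_mem' _ := Submodule.zero_mem _
  add_mem' hT hT' σ := add_mem (hT σ) (hT' σ)
  smul_mem' c _ hT σ := Submodule.smul_mem _ c (hT σ)

theorem pairsOn_mono {X Y : Set (Finset α × Finset α)} (h : X ⊆ Y) : pairsOn X ≤ pairsOn Y :=
  fun _ hT σ => Finsupp.supported_mono (s := {τ | (σ, τ) ∈ X}) (t := {τ | (σ, τ) ∈ Y})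
    (fun _ hτ => h hτ) (hT σ)

theorem pair_mem_pairsOn {X : Set (Finset α × Finset α)} {z : Finset α × Finset α} (hz : z ∈ X) :
    pair z ∈ pairsOn X := by
  intro ρ
  rw [pair, onBasis_e]
  split_ifs with h
  · subst h; exact e_mem_chainsOn hz
  · exact Submodule.zero_mem _

/-- The pairs in `X` of filtration at most `p` and total degree `n`. -/
def gradedPart (X : Set (Finset α × Finset α)) (p n : ℤ) : Set (Finset α × Finset α) :=
  {z | z ∈ X ∧ (z.1.card : ℤ) - 1 ≤ p ∧ (z.2.card : ℤ) - z.1.card = n}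

theorem gradedPart_mono (X : Set (Finset α × Finset α)) {p p' : ℤ} (h : p ≤ p') (n : ℤ) :
    gradedPart X p n ⊆ gradedPart X p' n :=
  fun _ hz => ⟨hz.1, hz.2.1.trans h, hz.2.2⟩

/-! ### Passing between coefficient vectors and endomorphisms -/

section Transfer

variable {I : Type*} (c : I → Finset α × Finset α)

/-- The dimension of the first simplex. -/
def dimFst (x : I) : ℤ := ((c x).1.card : ℤ) - 1

/-- The dimension of the second simplex. -/
def dimSnd (x : I) : ℤ := ((c x).2.card : ℤ) - 1

/-- The embedding of the free group on a family of pairs into the endomorphisms. -/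
noncomputable def toPairs : (I →₀ ℤ) →ₗ[ℤ] PairSpace α :=
  Finsupp.linearCombination ℤ fun x => pair (c x)

/-- The coefficients of an endomorphism at a finite family of pairs. -/
noncomputable def ofPairs [Finite I] : PairSpace α →ₗ[ℤ] (I →₀ ℤ) :=
  (Finsupp.linearEquivFunOnFinite ℤ ℤ I).symm.toLinearMap ∘ₗ
    LinearMap.pi fun x => Finsupp.lapply (c x).2 ∘ₗ LinearMap.applyₗ (e (c x).1)

theorem ofPairs_apply [Finite I] (T : PairSpace α) (x : I) :
    ofPairs c T x = T (e (c x).1) (c x).2 := rfl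

theorem toPairs_single (x : I) : toPairs c (Finsupp.single x 1) = pair (c x) := by
  simp [toPairs]

theorem pair_apply (z : Finset α × Finset α) (σ τ : Finset α) :
    pair z (e σ) τ = if z = (σ, τ) then 1 else 0 := by
  obtain ⟨σ', τ'⟩ := z
  rw [pair, onBasis_e]
  by_cases h1 : σ = σ'
  · subst h1
    simp [e, Finsupp.single_apply]
  · simp [h1, Ne.symm h1]

variable {c}

theorem toPairs_apply (hc : Function.Injective c) (y : I →₀ ℤ) (x : I) :
    toPairs c y (e (c x).1) (c x).2 = y x := by
  induction y using Finsupp.induction_linear with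
  | zero => simp
  | add f g hf hg => rw [map_add, LinearMap.add_apply, Finsupp.add_apply, hf, hg, Finsupp.add_apply]
  | single z b =>
    rw [← mul_one b, ← smul_eq_mul, ← Finsupp.smul_single, map_smul, toPairs_single,
      LinearMap.smul_apply, Finsupp.smul_apply, Finsupp.smul_apply, pair_apply]
    congr 1
    classical
    simp [Finsupp.single_apply, hc.eq_iff]

theorem toPairs_mem_pairsOn {X : Set (Finset α × Finset α)} {y : I →₀ ℤ}
    (hy : ∀ x ∈ y.support, c x ∈ X) : toPairs c y ∈ pairsOn X := by
  rw [toPairs, Finsupp.linearCombination_apply]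
  exact sum_mem fun x hx => Submodule.smul_mem _ _ (pair_mem_pairsOn (hy x hx))

theorem ofPairs_toPairs [Finite I] (hc : Function.Injective c) (y : I →₀ ℤ) :
    ofPairs c (toPairs c y) = y := by
  ext x
  rw [ofPairs_apply, toPairs_apply hc]

theorem toPairs_ofPairs [Finite I] (hc : Function.Injective c) {X : Set (Finset α × Finset α)}
    (hX : ∀ z, z ∈ X ↔ ∃ x, c x = z) {T : PairSpace α} (hT : T ∈ pairsOn X) :
    toPairs c (ofPairs c T) = T := by
  refine hom_ext_e fun σ => ?_
  ext τ
  by_cases h : (σ, τ) ∈ X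
  · obtain ⟨x, hx⟩ := (hX _).1 h
    have h1 := toPairs_apply hc (ofPairs c T) x
    rw [ofPairs_apply, hx] at h1
    exact h1
  · have key : ∀ T' ∈ pairsOn X, T' (e σ) τ = 0 := fun T' hT' => by
      by_contra h0
      exact h ((Finsupp.mem_supported ℤ _).1 (hT' σ) (Finsupp.mem_support_iff.2 h0))
    rw [key T hT, key _ (toPairs_mem_pairsOn fun x _ => (hX _).2 ⟨x, rfl⟩)]

theorem toPairs_mem_gradedPart {X : Set (Finset α × Finset α)} (hX : ∀ z, z ∈ X ↔ ∃ x, c x = z)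
    {p n : ℤ} {y : I →₀ ℤ} (hy : y ∈ basisFiltration (dimFst c) (dimSnd c) p n) :
    toPairs c y ∈ pairsOn (gradedPart X p n) := by
  refine toPairs_mem_pairsOn fun x hx => ⟨(hX _).2 ⟨x, rfl⟩, ?_⟩
  have h := (Finsupp.mem_supported ℤ y).1 hy hx
  simp only [Set.mem_ofPred_eq, dimFst, dimSnd] at h
  exact ⟨h.1, by have := h.2; omega⟩

theorem ofPairs_mem_basisFiltration [Finite I] {X : Set (Finset α × Finset α)} {p n : ℤ}
    {T : PairSpace α} (hT : T ∈ pairsOn (gradedPart X p n)) :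
    ofPairs c T ∈ basisFiltration (dimFst c) (dimSnd c) p n := by
  refine (Finsupp.mem_supported ℤ _).2 fun x hx => ?_
  have h1 : ofPairs c T x ≠ 0 := Finsupp.mem_support_iff.1 hx
  rw [ofPairs_apply] at h1
  have h2 := (Finsupp.mem_supported ℤ _).1 (hT (c x).1) (Finsupp.mem_support_iff.2 h1)
  simp only [Set.mem_ofPred_eq, gradedPart] at h2
  simp only [Set.mem_ofPred_eq, dimFst, dimSnd]
  omega

end Transfer

/-- `Φ` maps the endomorphisms supported on `X` to those supported on `Y`, raising the filtration
by at most `k` and the total degree by `m`. -/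
def IsGraded (X Y : Set (Finset α × Finset α)) (k m : ℤ)
    (Φ : PairSpace α →ₗ[ℤ] PairSpace α) : Prop :=
  ∀ p n, ∀ T ∈ pairsOn (gradedPart X p n), Φ T ∈ pairsOn (gradedPart Y (p + k) (n + m))

/-! ### Operators on endomorphisms as maps of free groups on pairs -/

section Op

variable {I J : Type*} [Finite I] [Finite J]
  {c : I → Finset α × Finset α} {c' : J → Finset α × Finset α}
  {X Y : Set (Finset α × Finset α)} {k m : ℤ} {Φ : PairSpace α →ₗ[ℤ] PairSpace α}

variable (c c') in
/-- The map of free groups on pairs that is induced by an operator on endomorphisms. -/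
noncomputable def pairOp (Φ : PairSpace α →ₗ[ℤ] PairSpace α) : (I →₀ ℤ) →ₗ[ℤ] (J →₀ ℤ) :=
  ofPairs c' ∘ₗ Φ ∘ₗ toPairs c

theorem pairOp_mem (hX : ∀ z, z ∈ X ↔ ∃ x, c x = z) (hΦ : IsGraded X Y k m Φ) (p n : ℤ)
    (y : I →₀ ℤ) (hy : y ∈ basisFiltration (dimFst c) (dimSnd c) p n) :
    pairOp c c' Φ y ∈ basisFiltration (dimFst c') (dimSnd c') (p + k) (n + m) :=
  ofPairs_mem_basisFiltration (hΦ _ _ _ (toPairs_mem_gradedPart hX hy))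

theorem toPairs_pairOp (hc' : Function.Injective c') (hX : ∀ z, z ∈ X ↔ ∃ x, c x = z)
    (hY : ∀ z, z ∈ Y ↔ ∃ x, c' x = z) (hΦ : IsGraded X Y k m Φ) (y : I →₀ ℤ) :
    toPairs c' (pairOp c c' Φ y) = Φ (toPairs c y) := by
  refine toPairs_ofPairs hc' hY ?_
  rw [LinearMap.comp_apply]
  induction y using Finsupp.induction_linear with
  | zero => rw [map_zero, map_zero]; exact Submodule.zero_mem _
  | add f g hf hg => rw [map_add, map_add]; exact add_mem hf hg
  | single z b =>
    rw [← mul_one b, ← smul_eq_mul, ← Finsupp.smul_single, map_smul, map_smul]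
    exact Submodule.smul_mem _ _ (pairsOn_mono (fun _ h => h.1) (hΦ _ _ _
      (toPairs_mem_gradedPart hX (single_mem_basisFiltration _ _ z))))

/-- Reading off coefficients in between loses nothing, because Φ lands in the endomorphisms
supported on Y. -/
theorem pairOp_comp {I' : Type*} [Finite I'] {c'' : I' → Finset α × Finset α}
    {Ψ : PairSpace α →ₗ[ℤ] PairSpace α} (hc' : Function.Injective c')
    (hX : ∀ z, z ∈ X ↔ ∃ x, c x = z) (hY : ∀ z, z ∈ Y ↔ ∃ x, c' x = z)
    (hΦ : IsGraded X Y k m Φ) :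
    pairOp c' c'' Ψ ∘ₗ pairOp c c' Φ = pairOp c c'' (Ψ ∘ₗ Φ) := by
  refine LinearMap.ext fun y => ?_
  change ofPairs c'' (Ψ (toPairs c' (pairOp c c' Φ y))) = _
  rw [toPairs_pairOp hc' hX hY hΦ]
  rfl

theorem toPairs_mem (hX : ∀ z, z ∈ X ↔ ∃ x, c x = z) (y : I →₀ ℤ) : toPairs c y ∈ pairsOn X :=
  toPairs_mem_pairsOn fun x _ => (hX _).2 ⟨x, rfl⟩

theorem pairOp_congr (hX : ∀ z, z ∈ X ↔ ∃ x, c x = z) {Ψ : PairSpace α →ₗ[ℤ] PairSpace α}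
    (h : ∀ T ∈ pairsOn X, Φ T = Ψ T) : pairOp c c' Φ = pairOp c c' Ψ :=
  LinearMap.ext fun y => congrArg (ofPairs c') (h _ (toPairs_mem hX y))

theorem pairOp_id (hc : Function.Injective c) : pairOp c c LinearMap.id = LinearMap.id :=
  LinearMap.ext fun y => ofPairs_toPairs hc y

theorem pairOp_add (Φ Ψ : PairSpace α →ₗ[ℤ] PairSpace α) :
    pairOp c c' (Φ + Ψ) = pairOp c c' Φ + pairOp c c' Ψ :=
  LinearMap.ext fun _ => map_add (ofPairs c') _ _

theorem pairOp_sub (Φ Ψ : PairSpace α →ₗ[ℤ] PairSpace α) :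
    pairOp c c' (Φ - Ψ) = pairOp c c' Φ - pairOp c c' Ψ :=
  LinearMap.ext fun _ => map_sub (ofPairs c') _ _

end Op

/-! ### Operators on one factor and the total differential -/

/-- Application of an operator, which may depend on `σ`, to the second factors. -/
noncomputable def mapSnd (φ : Finset α → PairSpace α) : PairSpace α →ₗ[ℤ] PairSpace α where
  toFun T := onBasis fun σ => φ σ (T (e σ))
  map_add' T T' := hom_ext_e fun σ => by simp
  map_smul' r T := hom_ext_e fun σ => by simp

@[simp] theorem mapSnd_apply_e (φ : Finset α → PairSpace α) (T : PairSpace α) (σ : Finset α) :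
    mapSnd φ T (e σ) = φ σ (T (e σ)) := by
  simp [mapSnd]

/-- Application of the transpose of an operator to the first factors. -/
noncomputable def mapFst (φ : PairSpace α) : PairSpace α →ₗ[ℤ] PairSpace α :=
  LinearMap.lcomp ℤ _ φ

@[simp] theorem mapFst_apply (φ : PairSpace α) (T : PairSpace α) (x : Finset α →₀ ℤ) :
    mapFst φ T x = T (φ x) := rfl

/-- Precomposition works backwards: the new value at ρ is built from the old values at the σ in `R
ρ`. So an operator that lowers dimensions of cochains raises the filtration, and the coboundary
lowers it. -/
theorem isGraded_mapFst {X Y : Set (Finset α × Finset α)} {k m : ℤ} {φ : PairSpace α}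
    (R : Finset α → Set (Finset α)) (hφ : ∀ ρ, φ (e ρ) ∈ chainsOn (R ρ))
    (h : ∀ ρ, ∀ σ ∈ R ρ, ∀ τ, (σ, τ) ∈ X →
      (ρ, τ) ∈ Y ∧ (ρ.card : ℤ) ≤ σ.card + k ∧ (σ.card : ℤ) = ρ.card + m) :
    IsGraded X Y k m (mapFst φ) := by
  intro p n T hT ρ
  refine map_mem_of_mem_chainsOn (φ := T) (fun σ hσ => ?_) (hφ ρ)
  refine Finsupp.supported_mono ?_ (hT σ)
  rintro τ ⟨h1, h2, h3⟩
  obtain ⟨h4, h5, h6⟩ := h ρ σ hσ τ h1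
  exact ⟨h4, by simp only at *; omega, by simp only at *; omega⟩

theorem isGraded_mapSnd {X Y : Set (Finset α × Finset α)} {m : ℤ}
    {φ : Finset α → PairSpace α} (R : Finset α → Finset α → Set (Finset α))
    (hφ : ∀ ρ τ, φ ρ (e τ) ∈ chainsOn (R ρ τ))
    (h : ∀ ρ τ, (ρ, τ) ∈ X → ∀ τ' ∈ R ρ τ,
      (ρ, τ') ∈ Y ∧ (τ'.card : ℤ) = τ.card + m) :
    IsGraded X Y 0 m (mapSnd φ) := by
  intro p n T hT ρ
  rw [mapSnd_apply_e]
  refine map_mem_of_mem_chainsOn (fun τ hτ => ?_) (hT ρ)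
  refine Finsupp.supported_mono ?_ (hφ ρ τ)
  intro τ' hτ'
  obtain ⟨h1, h2, h3⟩ := hτ
  obtain ⟨h4, h5⟩ := h ρ τ h1 τ' hτ'
  exact ⟨h4, by simp only at *; omega, by simp only at *; omega⟩

theorem IsGraded.add {X Y : Set (Finset α × Finset α)} {k k' m : ℤ}
    {Φ Ψ : PairSpace α →ₗ[ℤ] PairSpace α} (hΦ : IsGraded X Y k m Φ) (hΨ : IsGraded X Y k' m Ψ)
    (hk : k' ≤ k) : IsGraded X Y k m (Φ + Ψ) := fun p n T hT =>
  add_mem (hΦ p n T hT) (pairsOn_mono (gradedPart_mono Y (by omega) _) (hΨ p n T hT))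

theorem IsGraded.comp {X Y Y' : Set (Finset α × Finset α)} {k k' m m' : ℤ}
    {Φ Ψ : PairSpace α →ₗ[ℤ] PairSpace α} (hΨ : IsGraded Y Y' k' m' Ψ) (hΦ : IsGraded X Y k m Φ) :
    IsGraded X Y' (k + k') (m + m') (Ψ ∘ₗ Φ) := fun p n T hT => by
  have := hΨ _ _ _ (hΦ p n T hT)
  rwa [add_assoc, add_assoc] at this

theorem IsGraded.neg {X Y : Set (Finset α × Finset α)} {k m : ℤ}
    {Φ : PairSpace α →ₗ[ℤ] PairSpace α} (hΦ : IsGraded X Y k m Φ) : IsGraded X Y k m (-Φ) :=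
  fun p n T hT => neg_mem (hΦ p n T hT)

/-- The sign `(-1)^|σ|` times an operator on the second factors. -/
noncomputable def signed (φ : Finset α → PairSpace α) (σ : Finset α) : PairSpace α :=
  (-1 : ℤ) ^ σ.card • φ σ

/-- The differential `σ ⊗ τ ↦ dσ ⊗ τ + (-1)^|σ| σ ⊗ δτ`, where `d` is the transpose of `δ₁` and
`δ` is `δ₂`. -/
noncomputable def pairDiff (δ₁ δ₂ : PairSpace α) : PairSpace α →ₗ[ℤ] PairSpace α :=
  mapFst δ₁ + mapSnd (signed fun _ => δ₂)

/-- The sign depends only on the cardinality of the first simplex, so it is a scalar on chains of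
constant parity. -/
theorem mapSnd_signed_apply (φ T : PairSpace α) {X : Set (Finset α)} {ε : ℤ}
    (hX : ∀ σ ∈ X, (-1 : ℤ) ^ σ.card = ε) {x : Finset α →₀ ℤ} (hx : x ∈ chainsOn X) :
    mapSnd (signed fun _ => φ) T x = ε • φ (T x) := by
  have : chainsOn X ≤ LinearMap.ker (mapSnd (signed fun _ => φ) T - ε • (φ ∘ₗ T)) := by
    refine chainsOn_le fun σ hσ => ?_
    simp only [LinearMap.mem_ker, LinearMap.sub_apply, LinearMap.smul_apply, LinearMap.comp_apply,
      mapSnd_apply_e, signed, hX σ hσ, sub_self]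
  have h := this hx
  simp only [LinearMap.mem_ker, LinearMap.sub_apply, LinearMap.smul_apply, LinearMap.comp_apply,
    sub_eq_zero] at h
  exact h

theorem mapSnd_signed_apply_e (φ : Finset α → PairSpace α) (T : PairSpace α) (σ : Finset α) :
    mapSnd (signed φ) T (e σ) = (-1 : ℤ) ^ σ.card • φ σ (T (e σ)) := by
  rw [mapSnd_apply_e, signed, LinearMap.smul_apply]

theorem pairDiff_apply_e (δ₁ δ₂ T : PairSpace α) (σ : Finset α) :
    pairDiff δ₁ δ₂ T (e σ) = T (δ₁ (e σ)) + (-1 : ℤ) ^ σ.card • δ₂ (T (e σ)) := by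
  rw [pairDiff, LinearMap.add_apply, LinearMap.add_apply, mapSnd_signed_apply_e, mapFst_apply]

theorem signed_mem {φ : Finset α → PairSpace α} {σ τ : Finset α} {X : Set (Finset α)}
    (h : φ σ (e τ) ∈ chainsOn X) : signed φ σ (e τ) ∈ chainsOn X := by
  rw [signed, LinearMap.smul_apply]
  exact Submodule.smul_mem _ _ h

theorem mapSnd_const (φ T : PairSpace α) : mapSnd (fun _ => φ) T = φ ∘ₗ T :=
  hom_ext_e fun σ => by simp

theorem apply_e_eq_zero {X : Set (Finset α × Finset α)} {T : PairSpace α} (hT : T ∈ pairsOn X)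
    {σ : Finset α} (hσ : ∀ τ, (σ, τ) ∉ X) : T (e σ) = 0 := by
  ext τ
  by_contra h
  exact hσ τ ((Finsupp.mem_supported ℤ _).1 (hT σ) (Finsupp.mem_support_iff.2 h))

/-- The two mixed terms cancel because the coboundary changes the parity of the first simplex. -/
theorem pairDiff_pairDiff {S : Finset α} {K : FinComplex α} {reduced : Bool} {δ₂ : PairSpace α}
    (h₂ : δ₂ ∘ₗ δ₂ = 0) (T : PairSpace α) :
    pairDiff (cob S (K.simplices reduced)) δ₂ (pairDiff (cob S (K.simplices reduced)) δ₂ T) =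
      0 := by
  refine hom_ext_e fun σ => ?_
  have h1 := LinearMap.congr_fun (cob_cob (K := K) (S := S) (reduced := reduced)) (e σ)
  have h2 := LinearMap.congr_fun h₂ (T (e σ))
  simp only [LinearMap.comp_apply, LinearMap.zero_apply] at h1 h2
  have h3 : ∀ τ ∈ {τ | σ ∈ K.simplices reduced ∧ τ ∈ K.simplices reduced ∧ σ ⊆ τ ∧
      τ.card = σ.card + 1}, (-1 : ℤ) ^ τ.card = (-1) ^ (σ.card + 1) :=
    fun τ hτ => by rw [hτ.2.2.2]
  rw [pairDiff_apply_e, pairDiff_apply_e]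
  conv_lhs => lhs; rw [pairDiff, LinearMap.add_apply, LinearMap.add_apply, mapFst_apply, h1,
    map_zero, mapSnd_signed_apply _ _ h3 (cob_mem _ σ)]
  rw [map_add, map_smul, h2, pow_succ]
  simp

/-- The pair of simplices of a flag. -/
def flagPair (K : FinComplex α) (reduced : Bool) (x : K.Flag reduced) : Finset α × Finset α := x.1

theorem flagPair_injective (K : FinComplex α) (reduced : Bool) :
    Function.Injective (flagPair K reduced) := Subtype.val_injective

theorem toPairs_gen (K : FinComplex α) (reduced : Bool) (σ τ : Finset α) :
    toPairs (flagPair K reduced) (K.gen reduced σ τ) =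
      if σ ∈ K.simplices reduced ∧ τ ∈ K.simplices reduced ∧ σ ⊆ τ then pair (σ, τ) else 0 := by
  unfold gen
  split_ifs with h
  · exact toPairs_single _ _
  · exact map_zero _

/-- The boundary is the transpose of the coboundary: ρ is a face of σ exactly when `insert w ρ = σ`
for some w ∉ ρ, and the signs agree by `vsign_insert_self`. -/
theorem toPairs_dLeft (K : FinComplex α) (reduced : Bool) {S : Finset α}
    (hS : ∀ τ ∈ K.faces, τ ⊆ S) (y : K.N reduced) :
    toPairs (flagPair K reduced) (K.dLeft reduced y) =
      mapFst (cob S (K.simplices reduced)) (toPairs (flagPair K reduced) y) := by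
  suffices h : toPairs (flagPair K reduced) ∘ₗ K.dLeft reduced =
      mapFst (cob S (K.simplices reduced)) ∘ₗ toPairs (flagPair K reduced) from LinearMap.congr_fun h y
  refine Finsupp.lhom_ext' fun x => LinearMap.ext_ring ?_
  have hx := x.2
  obtain ⟨σ, τ, hxστ⟩ : ∃ σ τ, x.1 = (σ, τ) := ⟨_, _, rfl⟩
  have hxp : flagPair K reduced x = (σ, τ) := hxστ
  rw [hxστ] at hx
  obtain ⟨hσ, hτ, hστ⟩ := hx
  refine hom_ext_e fun ρ => ?_
  simp only [LinearMap.comp_apply, Finsupp.lsingle_apply, toPairs_single, mapFst_apply,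
    hxp]
  simp only [dLeft, Finsupp.linearCombination_single, one_smul, map_sum, map_smul, toPairs_gen, hxστ,
    LinearMap.sum_apply, LinearMap.smul_apply]
  have hσS : σ ⊆ S := hS σ (mem_simplices.1 hσ).1
  by_cases hρ : ρ ∈ K.simplices reduced
  · have h1 : cob S (K.simplices reduced) (e ρ) =
        ∑ w ∈ S, cut (K.simplices reduced) (ins w (e ρ)) := by simp [cob, hρ]
    have h2 : ∀ w, pair (σ, τ) (cut (K.simplices reduced) (ins w (e ρ))) =
        if w ∈ σ ∧ ρ = σ.erase w then vsign σ w • e τ else 0 := by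
      intro w
      rw [cut_ins_e]
      by_cases hw : w ∈ ρ
      · have : ¬(w ∈ σ ∧ ρ = σ.erase w) := by
          rintro ⟨-, rfl⟩
          exact Finset.notMem_erase w σ hw
        rw [if_neg this, ins_e_of_mem hw, ite_self, map_zero]
      · have h3 : insert w ρ = σ ↔ w ∈ σ ∧ ρ = σ.erase w := by
          constructor
          · rintro rfl
            exact ⟨Finset.mem_insert_self _ _, (Finset.erase_insert hw).symm⟩
          · rintro ⟨h4, rfl⟩
            exact Finset.insert_erase h4
        by_cases h4 : insert w ρ = σ
        · rw [if_pos (h3.1 h4), if_pos (by rwa [h4]), ins_e_of_notMem hw, map_smul, pair, onBasis_e,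
            if_pos h4, ← h4, vsign_insert_self]
        · rw [if_neg fun h => h4 (h3.2 h)]
          split_ifs
          · rw [ins_e_of_notMem hw, map_smul, pair, onBasis_e, if_neg h4, smul_zero]
          · exact map_zero _
    rw [h1, map_sum]
    simp only [h2]
    rw [← Finset.sum_subset hσS fun w _ hw => if_neg fun h => hw h.1]
    refine Finset.sum_congr rfl fun w hw => ?_
    by_cases h3 : ρ = σ.erase w
    · rw [if_pos ⟨h3 ▸ hρ, hτ, (Finset.erase_subset _ _).trans hστ⟩, if_pos ⟨hw, h3⟩, pair,
        onBasis_e, if_pos h3]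
    · rw [if_neg (c := w ∈ σ ∧ _) fun h => h3 h.2]
      split_ifs
      · rw [pair, onBasis_e, if_neg h3, smul_zero]
      · simp
  · have h1 : cob S (K.simplices reduced) (e ρ) = 0 := by simp [cob, hρ]
    rw [h1, map_zero]
    refine Finset.sum_eq_zero fun w _ => ?_
    split_ifs with h2
    · have h3 : ρ ≠ σ.erase w := fun h => hρ (h ▸ h2.1)
      rw [pair, onBasis_e, if_neg h3, smul_zero]
    · simp

/-- Enlarging the range of the sum to S adds only vertices that already lie in τ or that lead out of
K; both contribute zero. -/
theorem toPairs_dRight (K : FinComplex α) (reduced : Bool) {S : Finset α}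
    (hS : ∀ τ ∈ K.faces, τ ⊆ S) (y : K.N reduced) :
    toPairs (flagPair K reduced) (K.dRight reduced y) =
      mapSnd (signed fun _ => cob S (K.simplices reduced)) (toPairs (flagPair K reduced) y) := by
  suffices h : toPairs (flagPair K reduced) ∘ₗ K.dRight reduced =
      mapSnd (signed fun _ => cob S (K.simplices reduced)) ∘ₗ toPairs (flagPair K reduced) from
    LinearMap.congr_fun h y
  refine Finsupp.lhom_ext' fun x => LinearMap.ext_ring ?_
  have hx := x.2
  obtain ⟨σ, τ, hxστ⟩ : ∃ σ τ, x.1 = (σ, τ) := ⟨_, _, rfl⟩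
  have hxp : flagPair K reduced x = (σ, τ) := hxστ
  rw [hxστ] at hx
  obtain ⟨hσ, hτ, hστ⟩ := hx
  refine hom_ext_e fun ρ => ?_
  simp only [LinearMap.comp_apply, Finsupp.lsingle_apply, toPairs_single,
    mapSnd_signed_apply_e, hxp]
  simp only [dRight, Finsupp.linearCombination_single, one_smul, map_sum, map_smul, toPairs_gen, hxστ,
    LinearMap.sum_apply, LinearMap.smul_apply]
  have hvert : ∀ w, w ∈ K.vertices ↔ ∃ τ ∈ K.faces, w ∈ τ := by simp [vertices]
  by_cases hρ : ρ = σ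
  swap
  · have h1 : ∀ τ, pair (σ, τ) (e ρ) = 0 := fun τ => by simp [pair, hρ]
    rw [h1, map_zero, smul_zero]
    refine smul_eq_zero_of_right _ (Finset.sum_eq_zero fun w _ => ?_)
    split_ifs
    · rw [h1, smul_zero]
    · simp
  subst hρ
  have h1 : ∀ τ, pair (ρ, τ) (e ρ) = e τ := fun τ => by simp [pair]
  have h2 : cob S (K.simplices reduced) (e τ) =
      ∑ w ∈ S, cut (K.simplices reduced) (ins w (e τ)) := by simp [cob, hτ]
  rw [h1, h2]
  congr 1
  have hsub : K.vertices \ τ ⊆ S := fun w hw => by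
    obtain ⟨τ', h3, h4⟩ := (hvert w).1 (Finset.mem_sdiff.1 hw).1
    exact hS τ' h3 h4
  rw [← Finset.sum_subset hsub]
  · refine Finset.sum_congr rfl fun w hw => ?_
    have hwτ := (Finset.mem_sdiff.1 hw).2
    rw [cut_ins_e, ins_e_of_notMem hwτ]
    by_cases h3 : insert w τ ∈ K.simplices reduced
    · rw [if_pos h3, if_pos ⟨hσ, h3, hστ.trans (Finset.subset_insert _ _)⟩, h1]
    · rw [if_neg h3, if_neg fun h => h3 h.2.1, LinearMap.zero_apply, smul_zero]
  · intro w _ hw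
    rw [cut_ins_e]
    by_cases hwτ : w ∈ τ
    · rw [ins_e_of_mem hwτ, ite_self]
    · refine if_neg fun h => hw (Finset.mem_sdiff.2 ⟨(hvert w).2 ⟨_, (mem_simplices.1 h).1, ?_⟩, hwτ⟩)
      exact Finset.mem_insert_self _ _

theorem toPairs_Delta (K : FinComplex α) (reduced : Bool) {S : Finset α}
    (hS : ∀ τ ∈ K.faces, τ ⊆ S) (y : K.N reduced) :
    toPairs (flagPair K reduced) (K.Delta reduced y) =
      pairDiff (cob S (K.simplices reduced)) (cob S (K.simplices reduced))
        (toPairs (flagPair K reduced) y) := by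
  rw [Delta, LinearMap.add_apply, map_add, toPairs_dLeft K reduced hS, toPairs_dRight K reduced hS,
    pairDiff, LinearMap.add_apply]

end Pairs

/-! ### The mixed bicomplex and the two retractions -/

section Invariance

variable {α : Type*} [LinearOrder α]

open FinComplex

/-- The pairs `σ ⊆ τ` of simplices of `K`. -/
def flagSet (K : FinComplex α) (reduced : Bool) : Set (Finset α × Finset α) :=
  {z | z.1 ∈ K.simplices reduced ∧ z.2 ∈ K.simplices reduced ∧ z.1 ⊆ z.2}

/-- The pairs of a simplex of the subdivision `K'` and a simplex of `K` that contains it. -/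
def mixedSet (K K' : FinComplex α) (s : Finset α) (a : α) (reduced : Bool) :
    Set (Finset α × Finset α) :=
  {z | z.1 ∈ K'.simplices reduced ∧ z.2 ∈ K.simplices reduced ∧ carrier s a z.1 ⊆ z.2}

/-- The pairs in `mixedSet`, as a type. -/
def MixedFlag (K K' : FinComplex α) (s : Finset α) (a : α) (reduced : Bool) : Type _ :=
  {z : Finset α × Finset α // z ∈ mixedSet K K' s a reduced}

/-- The pair of simplices of a mixed flag. -/
def mixedPair (K K' : FinComplex α) (s : Finset α) (a : α) (reduced : Bool)
    (x : MixedFlag K K' s a reduced) : Finset α × Finset α := x.1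

variable {K K' : FinComplex α} {s S : Finset α} {a v : α} {reduced : Bool}

theorem mem_flagSet_iff (z : Finset α × Finset α) :
    z ∈ flagSet K reduced ↔ ∃ x, flagPair K reduced x = z :=
  ⟨fun h => ⟨⟨z, h⟩, rfl⟩, by rintro ⟨x, rfl⟩; exact x.2⟩

theorem mem_mixedSet_iff (z : Finset α × Finset α) :
    z ∈ mixedSet K K' s a reduced ↔ ∃ x, mixedPair K K' s a reduced x = z :=
  ⟨fun h => ⟨⟨z, h⟩, rfl⟩, by rintro ⟨x, rfl⟩; exact x.2⟩

theorem mixedPair_injective : Function.Injective (mixedPair K K' s a reduced) :=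
  Subtype.val_injective

instance finite_mixedFlag : Finite (MixedFlag K K' s a reduced) := by
  refine Set.Finite.subset
    ((K'.simplices reduced ×ˢ K.simplices reduced : Finset _).finite_toSet) ?_
  rintro ⟨σ, τ⟩ ⟨h1, h2, -⟩
  simp only [Finset.coe_product, Set.mem_prod, Finset.mem_coe]
  exact ⟨h1, h2⟩

theorem Delta_eq_pairOp (hS : ∀ τ ∈ K.faces, τ ⊆ S) :
    K.Delta reduced = pairOp (flagPair K reduced) (flagPair K reduced)
      (pairDiff (cob S (K.simplices reduced)) (cob S (K.simplices reduced))) := by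
  refine LinearMap.ext fun y => ?_
  change _ = ofPairs _ (pairDiff _ _ (toPairs _ y))
  rw [← toPairs_Delta K reduced hS, ofPairs_toPairs (flagPair_injective K reduced)]

theorem isGraded_mapFst_cob_flagSet :
    IsGraded (flagSet K reduced) (flagSet K reduced) (-1) 1
      (mapFst (cob S (K.simplices reduced))) :=
  isGraded_mapFst _ (cob_mem _) fun ρ σ hσ τ hτ => by
    obtain ⟨h1, h2, h3, h4⟩ := hσ
    exact ⟨⟨h1, hτ.2.1, h3.trans hτ.2.2⟩, by omega, by omega⟩

theorem isGraded_mapFst_cob_mixedSet :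
    IsGraded (mixedSet K K' s a reduced) (mixedSet K K' s a reduced) (-1) 1
      (mapFst (cob S (K'.simplices reduced))) :=
  isGraded_mapFst _ (cob_mem _) fun ρ σ hσ τ hτ => by
    obtain ⟨h1, h2, h3, h4⟩ := hσ
    exact ⟨⟨h1, hτ.2.1, (carrier_mono h3).trans hτ.2.2⟩, by omega, by omega⟩

theorem isGraded_pairDiff_flagSet :
    IsGraded (flagSet K reduced) (flagSet K reduced) 0 1
      (pairDiff (cob S (K.simplices reduced)) (cob S (K.simplices reduced))) := by
  rw [pairDiff, add_comm]
  refine IsGraded.add ?_ isGraded_mapFst_cob_flagSet (by norm_num)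
  refine isGraded_mapSnd _ (fun ρ τ => signed_mem (cob_mem _ τ)) fun ρ τ hρ τ' hτ' => ?_
  obtain ⟨h1, h2, h3, h4⟩ := hτ'
  exact ⟨⟨hρ.1, h2, hρ.2.2.trans h3⟩, by omega⟩

theorem isGraded_pairDiff_mixedSet :
    IsGraded (mixedSet K K' s a reduced) (mixedSet K K' s a reduced) 0 1
      (pairDiff (cob S (K'.simplices reduced)) (cob S (K.simplices reduced))) := by
  rw [pairDiff, add_comm]
  refine IsGraded.add ?_ isGraded_mapFst_cob_mixedSet (by norm_num)
  refine isGraded_mapSnd _ (fun ρ τ => signed_mem (cob_mem _ τ)) fun ρ τ hρ τ' hτ' => ?_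
  obtain ⟨h1, h2, h3, h4⟩ := hτ'
  exact ⟨⟨hρ.1, h2, hρ.2.2.trans h3⟩, by omega⟩

/-- The mixed bicomplex retracts onto `N(K)`. -/
theorem nonempty_retract_mixed (h : IsStellar K K' s a) (hS : ∀ τ ∈ K.faces, τ ⊆ S) (haS : a ∈ S)
    (hne : s.Nonempty) :
    Nonempty (FilteredRetract
      (pairOp (mixedPair K K' s a reduced) (mixedPair K K' s a reduced)
        (pairDiff (cob S (K'.simplices reduced)) (cob S (K.simplices reduced))))
      (basisFiltration (dimFst (mixedPair K K' s a reduced))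
        (dimSnd (mixedPair K K' s a reduced)))
      (K.Delta reduced)
      (basisFiltration (dimFst (flagPair K reduced)) (dimSnd (flagPair K reduced)))) := by
  rw [Delta_eq_pairOp hS]
  have hne' := hne
  obtain ⟨v, hv⟩ := hne'
  have hcomm := coarsen_cob (reduced := reduced) h hS haS hne
  have hc := LinearMap.congr_fun hcomm
  have hpc := LinearMap.congr_fun (pullback_coarsen (reduced := reduced) h hS haS hv)
  have hpb := LinearMap.congr_fun (pullback_cob (reduced := reduced) h hS haS hv)
  have hcp := LinearMap.congr_fun (coarsen_pullback (reduced := reduced) h hS hv)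
  simp only [LinearMap.comp_apply, LinearMap.add_apply] at hc hpc hpb hcp
  have hD := isGraded_pairDiff_mixedSet (K := K) (K' := K') (s := s) (a := a) (S := S)
    (reduced := reduced)
  have hDK := isGraded_pairDiff_flagSet (K := K) (S := S) (reduced := reduced)
  have hproj : IsGraded (mixedSet K K' s a reduced) (flagSet K reduced) 0 0
      (mapFst (pullback (K.simplices reduced) (K'.simplices reduced) a v)) :=
    isGraded_mapFst _ (pullback_mem h hv) fun ρ σ hσ τ hτ => by
      obtain ⟨h1, h2, h3, h4, -⟩ := hσ
      exact ⟨⟨h1, hτ.2.1, h3.trans hτ.2.2⟩, by omega, by omega⟩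
  have hincl : IsGraded (flagSet K reduced) (mixedSet K K' s a reduced) 0 0
      (mapFst (coarsen S (K'.simplices reduced) s a)) :=
    isGraded_mapFst _ (coarsen_mem h) fun ρ σ hσ τ hτ => by
      obtain ⟨h1, h2, h3, h4⟩ := hσ
      exact ⟨⟨h1, hτ.2.1, h3.trans hτ.2.2⟩, by omega, by omega⟩
  have hhtpy : IsGraded (mixedSet K K' s a reduced) (mixedSet K K' s a reduced) 1 (-1)
      (mapFst (contr (K'.simplices reduced) a v)) :=
    isGraded_mapFst _ (contr_mem h hv) fun ρ σ hσ τ hτ => by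
      obtain ⟨h1, h2, h3, h4, -⟩ := hσ
      refine ⟨⟨h1, hτ.2.1, ?_⟩, by omega, by omega⟩
      rw [show carrier s a (ρ, τ).1 = _ from h3]
      exact hτ.2.2
  refine ⟨{
    proj := pairOp _ _ (mapFst (pullback (K.simplices reduced) (K'.simplices reduced) a v))
    incl := pairOp _ _ (mapFst (coarsen S (K'.simplices reduced) s a))
    htpy := pairOp _ _ (mapFst (contr (K'.simplices reduced) a v))
    sq_zero := ?_
    proj_comm := ?_
    incl_comm := ?_
    proj_incl := ?_
    incl_proj := ?_
    proj_le := fun p n x hx => by simpa using pairOp_mem mem_mixedSet_iff hproj p n x hx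
    incl_le := fun p n x hx => by simpa using pairOp_mem mem_flagSet_iff hincl p n x hx
    htpy_le := pairOp_mem mem_mixedSet_iff hhtpy }⟩
  · rw [pairOp_comp mixedPair_injective mem_mixedSet_iff mem_mixedSet_iff hD]
    refine LinearMap.ext fun y => ?_
    change ofPairs _ (pairDiff _ _ (pairDiff _ _ _)) = 0
    rw [pairDiff_pairDiff cob_cob, map_zero]
  · rw [pairOp_comp mixedPair_injective mem_mixedSet_iff mem_mixedSet_iff hD,
      pairOp_comp (flagPair_injective K reduced) mem_mixedSet_iff mem_flagSet_iff hproj]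
    refine pairOp_congr mem_mixedSet_iff fun T _ => hom_ext_e fun σ => ?_
    simp only [LinearMap.comp_apply]
    rw [pairDiff_apply_e, mapFst_apply, mapFst_apply, mapFst_apply, hpb, pairDiff,
      LinearMap.add_apply, LinearMap.add_apply, mapFst_apply,
      mapSnd_signed_apply _ _ (ε := (-1) ^ σ.card) _ (pullback_mem h hv σ)]
    rintro ρ ⟨-, -, -, h4, -⟩
    rw [h4]
  · rw [pairOp_comp (flagPair_injective K reduced) mem_flagSet_iff mem_flagSet_iff hDK,
      pairOp_comp mixedPair_injective mem_flagSet_iff mem_mixedSet_iff hincl]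
    refine pairOp_congr mem_flagSet_iff fun T _ => hom_ext_e fun σ => ?_
    simp only [LinearMap.comp_apply]
    rw [pairDiff_apply_e, mapFst_apply, mapFst_apply, mapFst_apply, hc, pairDiff,
      LinearMap.add_apply, LinearMap.add_apply, mapFst_apply,
      mapSnd_signed_apply _ _ (ε := (-1) ^ σ.card) _ (coarsen_mem h σ)]
    rintro ρ ⟨-, -, -, h4⟩
    rw [h4]
  · rw [pairOp_comp mixedPair_injective mem_flagSet_iff mem_mixedSet_iff hincl,
      ← pairOp_id (flagPair_injective K reduced)]
    refine pairOp_congr mem_flagSet_iff fun T hT => hom_ext_e fun σ => ?_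
    simp only [LinearMap.comp_apply, LinearMap.id_apply, mapFst_apply]
    rw [hcp, cut_e]
    split_ifs with hσ
    · rfl
    · rw [map_zero, apply_e_eq_zero hT fun τ hτ => hσ hτ.1]
  · rw [pairOp_comp (flagPair_injective K reduced) mem_mixedSet_iff mem_flagSet_iff hproj,
      pairOp_comp mixedPair_injective mem_mixedSet_iff mem_mixedSet_iff hhtpy,
      pairOp_comp mixedPair_injective mem_mixedSet_iff mem_mixedSet_iff hD,
      ← pairOp_id mixedPair_injective, ← pairOp_add, ← pairOp_add]
    refine pairOp_congr mem_mixedSet_iff fun T hT => hom_ext_e fun ρ => ?_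
    simp only [LinearMap.comp_apply, LinearMap.add_apply, LinearMap.id_apply]
    rw [pairDiff_apply_e]
    simp only [mapFst_apply]
    have hcut : T (cut (K'.simplices reduced) (e ρ)) = T (e ρ) := by
      rw [cut_e]
      split_ifs with hρ
      · rfl
      · rw [map_zero, apply_e_eq_zero hT fun τ hτ => hρ hτ.1]
    rw [hpc, map_add, map_add, hcut]
    -- Here `contr` drops one vertex of ρ, which flips the sign of the part of the differential on
    -- the second factor. That part therefore cancels in DH + HD.
    conv_rhs => rhs; rhs; rw [pairDiff, LinearMap.add_apply, LinearMap.add_apply, mapFst_apply,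
      mapSnd_signed_apply _ _ (ε := -(-1) ^ ρ.card) (by
        rintro σ ⟨-, -, -, h4, -⟩
        rw [← h4, pow_succ]; ring) (contr_mem h hv ρ)]
    rw [neg_smul]
    abel

/-- The bicomplex `N(K')` of the subdivision retracts onto the mixed bicomplex. -/
theorem nonempty_retract_subdivision (h : IsStellar K K' s a) (hS : ∀ τ ∈ K.faces, τ ⊆ S)
    (hS' : ∀ τ ∈ K'.faces, τ ⊆ S) (haS : a ∈ S) (hne : s.Nonempty) :
    Nonempty (FilteredRetract (K'.Delta reduced)
      (basisFiltration (dimFst (flagPair K' reduced)) (dimSnd (flagPair K' reduced)))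
      (pairOp (mixedPair K K' s a reduced) (mixedPair K K' s a reduced)
        (pairDiff (cob S (K'.simplices reduced)) (cob S (K.simplices reduced))))
      (basisFiltration (dimFst (mixedPair K K' s a reduced))
        (dimSnd (mixedPair K K' s a reduced)))) := by
  rw [Delta_eq_pairOp hS']
  have hc := LinearMap.congr_fun (coarsen_cob (reduced := reduced) h hS haS hne)
  -- No simplex of K' contains s, so each one misses a vertex of s. For other sets ρ any vertex of s
  -- serves as a default.
  have hv : ∀ ρ : Finset α, ∃ v ∈ s, ρ ∈ K'.simplices reduced → v ∉ ρ := by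
    intro ρ
    by_cases hρ : ρ ∈ K'.simplices reduced
    · obtain ⟨v, h1, h2⟩ := Finset.not_subset.1 ((h.mem_iff ρ).1 (mem_simplices.1 hρ).1).1
      exact ⟨v, h1, fun _ => h2⟩
    · obtain ⟨v, h1⟩ := hne
      exact ⟨v, h1, fun h2 => absurd h2 hρ⟩
  choose v hvs hv using hv
  have hpc := fun ρ => LinearMap.congr_fun
    (pullback_coarsen (reduced := reduced) h hS haS (hvs ρ))
  have hcp := fun ρ => LinearMap.congr_fun (coarsen_pullback (reduced := reduced) h hS (hvs ρ))
  have hcc := fun ρ => LinearMap.congr_fun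
    (coarsen_contr (reduced := reduced) (S := S) h (hvs ρ))
  simp only [LinearMap.comp_apply, LinearMap.add_apply, LinearMap.zero_apply] at hc hpc hcp hcc
  have hD := isGraded_pairDiff_flagSet (K := K') (S := S) (reduced := reduced)
  have hDM := isGraded_pairDiff_mixedSet (K := K) (K' := K') (s := s) (a := a) (S := S)
    (reduced := reduced)
  have hg : IsGraded (flagSet K' reduced) (mixedSet K K' s a reduced) 0 0
      (mapSnd fun _ => coarsen S (K'.simplices reduced) s a) :=
    isGraded_mapSnd _ (fun _ τ => coarsen_mem h τ) fun ρ τ hρ τ' hτ' => by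
      obtain ⟨h1, h2, h3, h4⟩ := hτ'
      exact ⟨⟨hρ.1, h2, (carrier_mono hρ.2.2).trans h3⟩, by omega⟩
  have hi : IsGraded (mixedSet K K' s a reduced) (flagSet K' reduced) 0 0
      (mapSnd fun ρ => pullback (K.simplices reduced) (K'.simplices reduced) a (v ρ)) :=
    isGraded_mapSnd (fun ρ τ => {ρ' | τ ∈ K.simplices reduced ∧ ρ' ∈ K'.simplices reduced ∧
        τ ⊆ carrier s a ρ' ∧ ρ'.card = τ.card ∧
        ∀ ρ₀, carrier s a ρ₀ ⊆ τ → v ρ ∉ ρ₀ → ρ₀ ⊆ ρ'})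
      (fun ρ τ => pullback_mem h (hvs ρ) τ) fun ρ τ hρ τ' hτ' => by
      obtain ⟨h1, h2, h3, h4, h5⟩ := hτ'
      exact ⟨⟨hρ.1, h2, h5 _ hρ.2.2 (hv ρ hρ.1)⟩, by omega⟩
  have hH : IsGraded (flagSet K' reduced) (flagSet K' reduced) 0 (-1)
      (mapSnd (signed fun ρ => contr (K'.simplices reduced) a (v ρ))) :=
    isGraded_mapSnd (fun ρ τ => {ρ' | τ ∈ K'.simplices reduced ∧ ρ' ∈ K'.simplices reduced ∧
        carrier s a τ = carrier s a ρ' ∧ ρ'.card + 1 = τ.card ∧ τ ⊆ insert (v ρ) ρ'})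
      (fun ρ τ => signed_mem (contr_mem h (hvs ρ) τ)) fun ρ τ hρ τ' hτ' => by
      obtain ⟨h1, h2, h3, h4, h5⟩ := hτ'
      refine ⟨⟨hρ.1, h2, fun x hx => ?_⟩, by omega⟩
      refine (Finset.mem_insert.1 (h5 (hρ.2.2 hx))).resolve_left ?_
      rintro rfl
      exact hv ρ hρ.1 hx
  have hF := isGraded_mapFst_cob_flagSet (K := K') (S := S) (reduced := reduced)
  have hinj := flagPair_injective K' reduced
  refine exists_filteredRetract_of_nilpotent
    (g := pairOp _ _ (mapSnd fun _ => coarsen S (K'.simplices reduced) s a))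
    (i := pairOp _ _
      (mapSnd fun ρ => pullback (K.simplices reduced) (K'.simplices reduced) a (v ρ)))
    (H := pairOp _ _ (mapSnd (signed fun ρ => contr (K'.simplices reduced) a (v ρ))))
    (basisFiltration_mono _ _) ?_ ?_ ?_ ?_
    (fun p n x hx => by simpa using pairOp_mem mem_flagSet_iff hD p n x hx)
    (fun p n x hx => by simpa using pairOp_mem mem_mixedSet_iff hDM p n x hx)
    (fun p n x hx => by simpa using pairOp_mem mem_flagSet_iff hg p n x hx)
    (fun p n x hx => by simpa using pairOp_mem mem_mixedSet_iff hi p n x hx)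
    (fun p n x hx => by
      have := pairOp_mem (c' := flagPair K' reduced) mem_flagSet_iff hH p n x hx
      simpa [sub_eq_add_neg] using this) ?_
  · rw [pairOp_comp hinj mem_flagSet_iff mem_flagSet_iff hD]
    refine LinearMap.ext fun y => ?_
    change ofPairs _ (pairDiff _ _ (pairDiff _ _ _)) = 0
    rw [pairDiff_pairDiff cob_cob, map_zero]
  · rw [pairOp_comp hinj mem_flagSet_iff mem_flagSet_iff hD,
      pairOp_comp mixedPair_injective mem_flagSet_iff mem_mixedSet_iff hg]
    refine pairOp_congr mem_flagSet_iff fun T _ => hom_ext_e fun σ => ?_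
    simp only [LinearMap.comp_apply, mapSnd_apply_e]
    rw [pairDiff_apply_e, pairDiff_apply_e, mapSnd_const, map_add, map_smul]
    simp only [LinearMap.comp_apply]
    rw [hc]
  · rw [pairOp_comp hinj mem_mixedSet_iff mem_flagSet_iff hi, ← pairOp_id mixedPair_injective]
    refine pairOp_congr mem_mixedSet_iff fun T hT => hom_ext_e fun σ => ?_
    simp only [LinearMap.comp_apply, mapSnd_apply_e, LinearMap.id_apply]
    rw [hcp, cut_of_mem_chainsOn (fun _ hτ => hτ.2.1) (hT σ)]
  · rw [pairOp_comp hinj mem_flagSet_iff mem_flagSet_iff hH]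
    refine LinearMap.ext fun y => ?_
    change ofPairs _ (mapSnd _ (mapSnd _ (toPairs _ y))) = 0
    have : ∀ T : PairSpace α, mapSnd (fun _ => coarsen S (K'.simplices reduced) s a)
        (mapSnd (signed fun ρ => contr (K'.simplices reduced) a (v ρ)) T) = 0 := fun T =>
      hom_ext_e fun σ => by
        rw [mapSnd_apply_e, mapSnd_signed_apply_e, map_smul, hcc, smul_zero, LinearMap.zero_apply]
    rw [this, map_zero]
  -- On the second factor alone the homotopy formula is exact, as the signs (-1)^|ρ| of H and of the
  -- differential multiply to one. What remains is the interaction of H with d on the first factor.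
  · have hν : pairOp (mixedPair K K' s a reduced) (flagPair K' reduced)
          (mapSnd fun ρ => pullback (K.simplices reduced) (K'.simplices reduced) a (v ρ)) ∘ₗ
          pairOp (flagPair K' reduced) (mixedPair K K' s a reduced)
            (mapSnd fun _ => coarsen S (K'.simplices reduced) s a) -
        pairOp (flagPair K' reduced) (flagPair K' reduced)
          (pairDiff (cob S (K'.simplices reduced)) (cob S (K'.simplices reduced))) ∘ₗ
          pairOp (flagPair K' reduced) (flagPair K' reduced)
          (mapSnd (signed fun ρ => contr (K'.simplices reduced) a (v ρ))) -
        pairOp (flagPair K' reduced) (flagPair K' reduced)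
          (mapSnd (signed fun ρ => contr (K'.simplices reduced) a (v ρ))) ∘ₗ
          pairOp (flagPair K' reduced) (flagPair K' reduced)
            (pairDiff (cob S (K'.simplices reduced)) (cob S (K'.simplices reduced))) -
        LinearMap.id =
        pairOp (flagPair K' reduced) (flagPair K' reduced)
          (-(mapFst (cob S (K'.simplices reduced)) ∘ₗ
              mapSnd (signed fun ρ => contr (K'.simplices reduced) a (v ρ)) +
            mapSnd (signed fun ρ => contr (K'.simplices reduced) a (v ρ)) ∘ₗ
              mapFst (cob S (K'.simplices reduced)))) := by
      rw [pairOp_comp mixedPair_injective mem_flagSet_iff mem_mixedSet_iff hg,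
        pairOp_comp hinj mem_flagSet_iff mem_flagSet_iff hH,
        pairOp_comp hinj mem_flagSet_iff mem_flagSet_iff hD, ← pairOp_id hinj,
        ← pairOp_sub, ← pairOp_sub, ← pairOp_sub]
      refine pairOp_congr mem_flagSet_iff fun T hT => hom_ext_e fun ρ => ?_
      simp only [LinearMap.comp_apply, LinearMap.sub_apply, LinearMap.neg_apply,
        LinearMap.add_apply, LinearMap.id_apply]
      rw [mapSnd_apply_e, mapSnd_apply_e, hpc,
        cut_of_mem_chainsOn (fun _ hτ => hτ.2.1) (hT ρ), pairDiff_apply_e, mapFst_apply,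
        mapSnd_signed_apply_e, mapSnd_signed_apply_e, mapSnd_signed_apply_e, pairDiff_apply_e,
        mapFst_apply, map_smul, map_add, map_smul, smul_add, smul_smul, smul_smul, ← mul_pow]
      simp only [mul_neg, mul_one, neg_neg, one_pow, one_smul]
      abel
    rw [hν]
    -- In both error terms H preserves the filtration and d lowers it by one.
    refine isNilpotent_of_lowers_filtration (a := dimFst (flagPair K' reduced))
      (b := dimSnd (flagPair K' reduced)) fun p n y hy => ?_
    have h1 := hF.comp hH
    have h2 := hH.comp hF
    rw [show (0 : ℤ) + -1 = -1 by norm_num, show (-1 : ℤ) + 1 = 0 by norm_num] at h1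
    rw [show (-1 : ℤ) + 0 = -1 by norm_num, show (1 : ℤ) + -1 = 0 by norm_num] at h2
    simpa using pairOp_mem (c' := flagPair K' reduced) mem_flagSet_iff (h1.add h2 le_rfl).neg
      p n y hy

/-- A set without a lies in the join of ∂σ and the link exactly when it does not contain σ and its
union with σ is in K. Together with the simplices outside the star, these are all simplices of K
that do not contain σ. -/
theorem isStellar_stellarSubdivision (K : FinComplex α) (σ : Finset α) (hσ : σ ∈ K.faces)
    (hne : σ.Nonempty) (a : α) (ha : {a} ∉ K.faces) :
    IsStellar K (K.stellarSubdivision σ hσ hne a) σ a where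
  apex_notMem τ hτ haτ := ha (K.down_closed hτ (Finset.singleton_subset_iff.2 haτ))
  mem_faces := hσ
  mem_iff τ := by
    have hapex : ∀ τ ∈ K.faces, a ∉ τ := fun τ hτ haτ =>
      ha (K.down_closed hτ (Finset.singleton_subset_iff.2 haτ))
    have haσ := hapex σ hσ
    have hmem : τ ∈ (K.stellarSubdivision σ hσ hne a).faces ↔
        (τ ∈ K.faces ∧ τ ∉ K.star σ) ∨ τ ∈ cone a (join (boundary σ) (K.link σ)) := by
      simp [stellarSubdivision]
    rw [hmem, mem_cone_boundary_link]
    constructor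
    · rintro (⟨h1, h2⟩ | ⟨u, hu, r, hr, t, ht, rfl⟩)
      · refine ⟨fun hs => h2 (Finset.mem_filter.2 ⟨h1, ?_⟩),
          fun h3 => absurd h3 (hapex τ h1), fun _ => h1⟩
        rwa [Finset.union_eq_right.2 hs]
      · obtain ⟨h1, h2, h3⟩ := Finset.mem_filter.1 ht
        have hat := hapex t h1
        refine ⟨fun hs => ?_, fun _ => ?_, fun h4 => ?_⟩
        · refine hr.2 fun x hx => ?_
          rcases Finset.mem_union.1 (hs hx) with h4 | h4
          · exact absurd (Finset.mem_singleton.1 (hu h4) ▸ hx) haσ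
          · refine (Finset.mem_union.1 h4).resolve_right fun h5 => ?_
            exact Finset.notMem_empty x (h3 ▸ Finset.mem_inter.2 ⟨hx, h5⟩)
        · refine K.down_closed h2 (Finset.union_subset Finset.subset_union_left fun x hx => ?_)
          obtain ⟨hxa, hx⟩ := Finset.mem_erase.1 hx
          rcases Finset.mem_union.1 hx with h4 | h4
          · exact absurd (Finset.mem_singleton.1 (hu h4)) hxa
          · exact Finset.union_subset_union_left hr.1 h4
        · refine K.down_closed h2 fun x hx => ?_
          rcases Finset.mem_union.1 hx with h5 | h5
          · exact absurd (Finset.mem_singleton.1 (hu h5) ▸ hx) h4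
          · exact Finset.union_subset_union_left hr.1 h5
    · rintro ⟨h1, h2, h3⟩
      have hcone : σ ∪ τ.erase a ∈ K.faces → ∃ u ⊆ ({a} : Finset α), ∃ r, r ⊂ σ ∧
          ∃ t ∈ K.link σ, τ = u ∪ (r ∪ t) := by
        intro h4
        -- The parts of τ in the apex, in the boundary of σ and in the link.
        refine ⟨τ ∩ {a}, Finset.inter_subset_right, τ ∩ σ,
          ⟨Finset.inter_subset_right, fun h5 => h1 fun x hx => (Finset.mem_inter.1 (h5 hx)).1⟩,
          τ.erase a \ σ, Finset.mem_filter.2 ⟨K.down_closed h4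
            (Finset.sdiff_subset.trans Finset.subset_union_right), ?_,
            Finset.inter_sdiff_self σ _⟩, ?_⟩
        · rwa [Finset.union_sdiff_self_eq_union]
        · ext x
          by_cases hxa : x = a <;> by_cases hxσ : x ∈ σ <;> simp [hxa, hxσ]
          all_goals simp_all
      by_cases haτ : a ∈ τ
      · exact Or.inr (hcone (h2 haτ))
      · by_cases hst : τ ∈ K.star σ
        · refine Or.inr (hcone ?_)
          rw [Finset.erase_eq_of_notMem haτ]
          exact (Finset.mem_filter.1 hst).2
        · exact Or.inl ⟨h3 haτ, hst⟩

theorem nonempty_retract (h : IsStellar K K' s a) (hne : s.Nonempty) (reduced : Bool) :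
    Nonempty (FilteredRetract (K'.Delta reduced)
      (basisFiltration (dimLeft K' reduced) (dimRight K' reduced)) (K.Delta reduced)
      (basisFiltration (dimLeft K reduced) (dimRight K reduced))) := by
  set S : Finset α := insert a (K.vertices ∪ K'.vertices) with hSdef
  have hS : ∀ τ ∈ K.faces, τ ⊆ S := fun τ hτ x hx => Finset.mem_insert_of_mem
    (Finset.mem_union_left _ (Finset.mem_biUnion.2 ⟨τ, hτ, hx⟩))
  have hS' : ∀ τ ∈ K'.faces, τ ⊆ S := fun τ hτ x hx => Finset.mem_insert_of_mem
    (Finset.mem_union_right _ (Finset.mem_biUnion.2 ⟨τ, hτ, hx⟩))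
  have haS : a ∈ S := Finset.mem_insert_self _ _
  obtain ⟨R⟩ := nonempty_retract_subdivision (reduced := reduced) h hS hS' haS hne
  obtain ⟨R'⟩ := nonempty_retract_mixed (reduced := reduced) h hS haS hne
  -- The degrees `dimFst` and `dimSnd` of `flagPair` unfold to `dimLeft` and `dimRight`, so the
  -- filtrations agree by definition.
  exact ⟨R.trans R'⟩

end Invariance

end Homeology

theorem theorem3 {α : Type*} [LinearOrder α] (K : FinComplex α) (σ : Finset α)
    (hσ : σ ∈ K.faces) (hne : σ.Nonempty) (hdim : 0 < (σ.card : ℤ) - 1)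
    (a : α) (ha : {a} ∉ K.faces)
    (K' : FinComplex α) (hK' : K' = K.stellarSubdivision σ hσ hne a)
    (G : Type*) [AddCommGroup G] (p q : ℤ) :
    Nonempty (Homeology.CohomeologyGroup K' false G p q ≃+
        Homeology.CohomeologyGroup K false G p q) ∧
      Nonempty (Homeology.CohomeologyGroup K' true G p q ≃+
        Homeology.CohomeologyGroup K true G p q) ∧
      Nonempty (Homeology.HomeologyGroup K' false G p q ≃+
        Homeology.HomeologyGroup K false G p q) ∧
      Nonempty (Homeology.HomeologyGroup K' true G p q ≃+
        Homeology.HomeologyGroup K true G p q) := by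
  have h : Homeology.IsStellar K K' σ a :=
    hK' ▸ Homeology.isStellar_stellarSubdivision K σ hσ hne a ha
  obtain ⟨R⟩ := Homeology.nonempty_retract h hne false
  obtain ⟨R'⟩ := Homeology.nonempty_retract h hne true
  exact ⟨Homeology.nonempty_cohomeologyGroup_equiv R G p q,
    Homeology.nonempty_cohomeologyGroup_equiv R' G p q,
    Homeology.nonempty_homeologyGroup_equiv R G p q,
    Homeology.nonempty_homeologyGroup_equiv R' G p q⟩
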